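/- Let $d\in\mathbb N$, $T>0$, $\delta,\lambda>0$, and let $\Omega$ be one of the following: (a) $\Omega=\mathbb R^d$; (b) a compact subset $\Omega\subset\mathbb R^d$ whose geodesic distance $d_\Omega(x,y)$ (the infimum of the lengths of rectifiable curves in $\Omega$ from $x$ to $y$, $+\infty$ if there is none) induces the Euclidean topology on $\Omega$, i.e. $d_\Omega(x_n,x)\to0$ whenever $x_n\to x$ in $\Omega$ (this holds e.g. for convex sets and for the closures of bounded smooth domains); (c) the torus $\Omega=\mathbb T^d=\mathbb R^d/\mathbb Z^d$. Write $G=\mathbb R^d$ in cases (a), (b) and $G=\mathbb T^d$ in case (c). Let $\Psi:\Omega\to\mathbb R$ be continuous and either bounded or Lipschitz; let $\eta:G\to\mathbb R$ be continuous, bounded, nonnegative, and even, $\eta(-z)=\eta(z)$; let $m_0$ be a Borel probability measure on $\Omega$ with $\int_\Omega \Psi^+\,dm_0<\infty$ (automatic if $\Psi$ is bounded). Let $\Gamma=C([0,T];\Omega)$ with the topology of uniform convergence, let $e_0(\gamma)=\gamma(0)$, and let $\mathcal Q_{m_0}$ be the set of Borel probability measures $Q$ on $\Gamma$ with $(e_0)_\#Q=m_0$.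 A curve $w:[0,T]\to G$ belongs to $H^1$ if there is $w'\in L^2([0,T];\mathbb R^d)$ such that $w(t)-w(s)=\int_s^t w'(r)\,dr$ for all $s,t\in[0,T]$ (modulo $\mathbb Z^d$ in case (c)). For $\gamma,\omega\in\Gamma$ and $Q$ a probability measure on $\Gamma$ put $$K(\gamma)=\tfrac12\int_0^T|\gamma'|^2dt \text{ if }\gamma\in H^1,\qquad K(\gamma)=+\infty\text{ otherwise},$$ $$V(\gamma,\omega)=\tfrac12\int_0^T|(\gamma-\omega)'(t)|^2\,\eta(\gamma(t)-\omega(t))\,dt\text{ if }\gamma-\omega\in H^1,\qquad V(\gamma,\omega)=+\infty\text{ otherwise},$$ $$F(\gamma,Q)=\delta K(\gamma)+\Psi(\gamma(T))+\lambda\int_\Gamma V(\gamma,\omega)\,dQ(\omega)\in\mathbb R\cup\{+\infty\}.$$ Then the mean-field game $MFG(\Omega,\Psi,\delta,\eta,\lambda,m_0)$ has a Lagrangian equilibrium, i.e. there exists $Q\in\mathcal Q_{m_0}$ such that $$\int_\Gamma F(\gamma,Q)\,dQ(\gamma)<\infty\quad\text{and}\quad F(\gamma,Q)=\inf_{\omega\in\Gamma,\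 \omega(0)=\gamma(0)}F(\omega,Q)\quad\text{for every }\gamma\in\operatorname{spt}(Q),$$ where $\int_\Gamma F(\gamma,Q)\,dQ(\gamma)<\infty$ means that the positive part of $F(\cdot,Q)$ is $Q$-integrable. -/

import Mathlib

open MeasureTheory Set

open scoped ENNReal

noncomputable section

namespace VelocityMFG

/-- The Euclidean space `ℝ^d`. -/
abbrev Vec (d : ℕ) : Type := EuclideanSpace ℝ (Fin d)

/-- The `d`-dimensional torus `ℝ^d / ℤ^d`. -/
abbrev Torus (d : ℕ) : Type := UnitAddTorus (Fin d)

/-- The canonical projection of `ℝ^d` onto the torus. -/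
def torusProj (d : ℕ) (x : Vec d) : Torus d := fun i => (x i : UnitAddCircle)

/-- The space `Γ` of continuous curves `[0,T] → Ω`; the topology of continuous maps is that of
uniform convergence, since `[0,T]` is compact. -/
abbrev Curve {G : Type} [TopologicalSpace G] (T : ℝ) (Ω : Set G) : Type :=
  C(Icc (0 : ℝ) T, Ω)

instance {G : Type} [TopologicalSpace G] (T : ℝ) (Ω : Set G) :
    MeasurableSpace (Curve T Ω) := borel _

instance {G : Type} [TopologicalSpace G] (T : ℝ) (Ω : Set G) : BorelSpace (Curve T Ω) := ⟨rfl⟩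

/-! In the following definitions the ambient space is an additive group `G` with a projection
`p : ℝ^d → G`. It is used for `G = ℝ^d` with `p = id`, and for the torus with its canonical
projection. Velocities take their values in `ℝ^d` in both cases. -/

/-- `v` is a square integrable (weak) time derivative of the `G`-valued curve `w` on `[0,T]`:
the increments of `w` are the (projected) integrals of `v`. -/
def IsVelocity {d : ℕ} {G : Type} [AddCommGroup G] (p : Vec d → G) {T : ℝ}
    (w : Icc (0 : ℝ) T → G) (v : ℝ → Vec d) : Prop :=
  MemLp v 2 (volume.restrict (Icc 0 T)) ∧
    ∀ s t : Icc (0 : ℝ) T, w t - w s = p (∫ r in (s : ℝ)..(t : ℝ), v r)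

/-- `w ∈ H¹([0,T])`. -/
def MemH1 {d : ℕ} {G : Type} [AddCommGroup G] (p : Vec d → G) {T : ℝ}
    (w : Icc (0 : ℝ) T → G) : Prop :=
  ∃ v : ℝ → Vec d, IsVelocity p w v

open Classical in
/-- The derivative `w'` of an `H¹` curve (unique up to a null set of times); zero by convention
if `w` is not in `H¹`, a value that is never used. -/
def velocity {d : ℕ} {G : Type} [AddCommGroup G] (p : Vec d → G) {T : ℝ}
    (w : Icc (0 : ℝ) T → G) : ℝ → Vec d :=
  if h : MemH1 p w then h.choose else 0

open Classical in
/-- The kinetic energy `K(γ) = ½ ∫₀ᵀ |γ'(t)|² dt`, equal to `+∞` if `γ ∉ H¹`. -/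
def kineticEnergy {d : ℕ} {G : Type} [AddCommGroup G] [TopologicalSpace G] (p : Vec d → G)
    {T : ℝ} {Ω : Set G} (γ : Curve T Ω) : ℝ≥0∞ :=
  if MemH1 p (fun t => (γ t : G)) then
    2⁻¹ * ∫⁻ t in Icc (0 : ℝ) T, ‖velocity p (fun s => (γ s : G)) t‖ₑ ^ 2
  else ⊤

open Classical in
/-- The interaction cost `V(γ, ω) = ½ ∫₀ᵀ |γ'(t) - ω'(t)|² η(γ(t) - ω(t)) dt`, equal to `+∞` if
`γ - ω ∉ H¹`. It is used for nonnegative `η` only. -/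
def interaction {d : ℕ} {G : Type} [AddCommGroup G] [TopologicalSpace G] (p : Vec d → G)
    (η : G → ℝ) {T : ℝ} {Ω : Set G} (γ ω : Curve T Ω) : ℝ≥0∞ :=
  if MemH1 p (fun t => (γ t : G) - (ω t : G)) then
    2⁻¹ * ∫⁻ t : Icc (0 : ℝ) T, ‖velocity p (fun s => (γ s : G) - (ω s : G)) t‖ₑ ^ 2 *
      ENNReal.ofReal (η ((γ t : G) - (ω t : G))) ∂(volume.comap Subtype.val)
  else ⊤

/-- The total cost `F(γ, Q) = δ K(γ) + Ψ(γ(T)) + λ ∫ V(γ, ω) dQ(ω)`, with values in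
`ℝ ∪ {+∞}`. -/
def totalCost {d : ℕ} {G : Type} [AddCommGroup G] [TopologicalSpace G] (p : Vec d → G)
    {T : ℝ} (hT : 0 < T) {Ω : Set G} (Ψ : Ω → ℝ) (δ : ℝ) (η : G → ℝ) (lam : ℝ)
    (γ : Curve T Ω) (Q : Measure (Curve T Ω)) : EReal :=
  ((ENNReal.ofReal δ * kineticEnergy p γ : ℝ≥0∞) : EReal)
    + ((Ψ (γ ⟨T, right_mem_Icc.2 hT.le⟩) : ℝ) : EReal)
    + ((ENNReal.ofReal lam * ∫⁻ ω, interaction p η γ ω ∂Q : ℝ≥0∞) : EReal)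

/-- The evaluation map `e₀ : Γ → Ω` at time `0`. -/
def evalZero {G : Type} [TopologicalSpace G] {T : ℝ} (hT : 0 < T) {Ω : Set G}
    (γ : Curve T Ω) : Ω :=
  γ ⟨0, left_mem_Icc.2 hT.le⟩

/-- The set `𝒬_{m₀}` of probability measures on curves whose initial distribution is `m₀`. -/
def initialLaw {G : Type} [TopologicalSpace G] [MeasurableSpace G] {T : ℝ} (hT : 0 < T)
    {Ω : Set G} (m₀ : Measure Ω) : Set (Measure (Curve T Ω)) :=
  {Q | IsProbabilityMeasure Q ∧ Q.map (evalZero hT) = m₀}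

/-- `Q` is a (Lagrangian) equilibrium of `MFG(Ω, Ψ, δ, η, λ, m₀)`. The inequality
`∫ F(γ, Q) dQ(γ) < ∞` is expressed by the finiteness of the integral of the positive part of
`F(·, Q)`. -/
structure IsEquilibrium {d : ℕ} {G : Type} [AddCommGroup G] [TopologicalSpace G]
    [MeasurableSpace G] (p : Vec d → G) {T : ℝ} (hT : 0 < T) {Ω : Set G} (Ψ : Ω → ℝ) (δ : ℝ)
    (η : G → ℝ) (lam : ℝ) (m₀ : Measure Ω) (Q : Measure (Curve T Ω)) : Prop where
  mem_initialLaw : Q ∈ initialLaw hT m₀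
  finite_cost : ∫⁻ γ, (totalCost p hT Ψ δ η lam γ Q).toENNReal ∂Q < ⊤
  optimal : ∀ γ ∈ Q.support,
    totalCost p hT Ψ δ η lam γ Q =
      ⨅ (ω : Curve T Ω) (_ : evalZero hT ω = evalZero hT γ), totalCost p hT Ψ δ η lam ω Q

/-- The geodesic distance of `Ω` induces on `Ω` the Euclidean topology: points of `Ω` that are
close to `x ∈ Ω` are joined to `x` by curves in `Ω` of small length (an `ε`-Lipschitz curve on
`[0,1]` has length at most `ε`, and a curve of length at most `ε` has such a
parametrization). -/
def GeodesicTopologyAgrees {d : ℕ} (Ω : Set (Vec d)) : Prop :=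
  ∀ x ∈ Ω, ∀ ε : NNReal, 0 < ε → ∃ r : ℝ, 0 < r ∧ ∀ y ∈ Ω, dist y x < r →
    ∃ σ : ℝ → Vec d, LipschitzOnWith ε σ (Icc 0 1) ∧ MapsTo σ (Icc 0 1) Ω ∧ σ 0 = x ∧ σ 1 = y

end VelocityMFG

end

noncomputable section

namespace VelocityMFG

open Filter Topology
open scoped RealInnerProductSpace

/-! ### Lower semicontinuity of integrals and lifting of laws. -/

section Abstract

/-! Since the interaction is symmetric, this is a potential game. Let c be the individual cost,
normalized to be nonnegative, let V include the factor λ, and put J(Q) = ∬ c(γ) + c(ω) + V(γ,ω) dQ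
dQ. The first variation of J at Q towards Q' is 2 ∫ (c + ∫ V dQ) d(Q' − Q). A minimizer Q of J under
the initial law therefore also minimizes the mean cost of a player facing Q, among laws Q' of finite
mean individual cost with the same initial law (`lintegral_playerCost_le_of_isMin`).

The minimizer comes from the direct method (`exists_potential_minimizer`). Bounded cost gives Hölder
bounds, hence tightness by Arzelà–Ascoli. The pair cost is lower semicontinuous because bounded
velocities converge weakly in L² while the weights η(γ − ω) converge uniformly
(`weightedEnergy_le_of_weak`, `lowerSemicontinuous_totalPair`).

Optimality at every point of the support needs one more idea (`exists_potential_equilibrium`). If ω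
beats a curve γ of the support with the same starting point, lower semicontinuity gives a
neighbourhood of γ, of positive mass, on which the cost exceeds that of ω by a margin. Its curves
start near ω(0), not at it, so they must be replaced by curves that keep the initial law and cost
barely more than ω. These are translates of ω on the whole group (`liftsInitialLaws_of_eq_univ`),
and a short connecting curve followed by a delayed ω in a compact domain
(`liftsInitialLaws_of_isCompact`). They are cheap because their velocities converge strongly, and
the player cost is continuous for that convergence (`tendsto_playerCost`).

The normalization changes the cost only by a function of γ(0) (`totalCost_eq`), hence does not
affect optimality. -/

lemma lowerSemicontinuous_of_seq {X : Type*} [TopologicalSpace X] [FirstCountableTopology X]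
    {f : X → ℝ≥0∞}
    (h : ∀ (u : ℕ → X) (x : X), Tendsto u atTop (𝓝 x) → f x ≤ liminf (fun n => f (u n)) atTop) :
    LowerSemicontinuous f := by
  intro x y hy
  by_contra hcon
  rw [Filter.not_eventually] at hcon
  obtain ⟨u, hu, hu'⟩ := Filter.exists_seq_forall_of_frequently hcon
  have h1 : liminf (fun n => f (u n)) atTop ≤ y :=
    (liminf_le_liminf (Eventually.of_forall fun n => not_lt.1 (hu' n))).trans_eq (by simp)
  exact absurd ((h u x hu).trans h1) (not_le.2 hy)

/-- Layer-cake formula: superlevel sets are open, so the portmanteau inequality applies to each of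
them, and Fatou's lemma integrates over the levels. The bound on `f` makes it real-valued. -/
lemma lintegral_le_liminf_of_lowerSemicontinuous {X : Type*} [TopologicalSpace X]
    [MeasurableSpace X] [BorelSpace X] [HasOuterApproxClosed X] {f : X → ℝ≥0∞}
    (hf : LowerSemicontinuous f) {C : ℝ≥0∞} (hC : C ≠ ⊤) (hfC : ∀ x, f x ≤ C)
    {μs : ℕ → ProbabilityMeasure X} {μ : ProbabilityMeasure X}
    (hμ : Tendsto μs atTop (𝓝 μ)) :
    ∫⁻ x, f x ∂(μ : Measure X) ≤ liminf (fun n => ∫⁻ x, f x ∂(μs n : Measure X)) atTop := by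
  have hfin : ∀ x, f x ≠ ⊤ := fun x => ((hfC x).trans_lt hC.lt_top).ne
  have hrw : ∀ ν : Measure X,
      ∫⁻ x, f x ∂ν = ∫⁻ t in Ioi (0 : ℝ), ν {a | t < (f a).toReal} := by
    intro ν
    rw [← lintegral_eq_lintegral_meas_lt ν (f := fun x => (f x).toReal)
      (Eventually.of_forall fun x => ENNReal.toReal_nonneg) hf.measurable.ennreal_toReal.aemeasurable]
    exact lintegral_congr fun x => (ENNReal.ofReal_toReal (hfin x)).symm
  simp_rw [hrw]
  calc ∫⁻ t in Ioi (0 : ℝ), (μ : Measure X) {a | t < (f a).toReal}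
      ≤ ∫⁻ t in Ioi (0 : ℝ), liminf (fun n => (μs n : Measure X) {a | t < (f a).toReal}) atTop := by
        refine setLIntegral_mono' measurableSet_Ioi fun t ht => ?_
        refine ProbabilityMeasure.le_liminf_measure_open_of_tendsto hμ ?_
        have : {a | t < (f a).toReal} = f ⁻¹' Ioi (ENNReal.ofReal t) := by
          ext a
          simp only [mem_ofPred_eq, mem_preimage, mem_Ioi]
          rw [ENNReal.ofReal_lt_iff_lt_toReal (le_of_lt ht) (hfin a)]
        rw [this]
        exact hf.isOpen_preimage _
    _ ≤ _ := lintegral_liminf_le fun n => Antitone.measurable fun s t hst =>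
        measure_mono fun ω hω => lt_of_le_of_lt hst hω

/-- By monotone convergence the integral is the supremum over n of the integrals of the truncations
at height n, each covered by the bounded case. -/
lemma lowerSemicontinuous_lintegral_probabilityMeasure {X : Type*} [TopologicalSpace X]
    [MeasurableSpace X] [BorelSpace X] [TopologicalSpace.MetrizableSpace X] [SecondCountableTopology X]
    {f : X → ℝ≥0∞} (hf : LowerSemicontinuous f) :
    LowerSemicontinuous fun μ : ProbabilityMeasure X => ∫⁻ x, f x ∂(μ : Measure X) := by
  have h1 : ∀ n : ℕ, LowerSemicontinuous fun x => f x ⊓ (n : ℝ≥0∞) :=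
    fun n => hf.inf lowerSemicontinuous_const
  have h2 : ∀ μ : ProbabilityMeasure X, ∫⁻ x, f x ∂(μ : Measure X) =
      ⨆ n : ℕ, ∫⁻ x, f x ⊓ (n : ℝ≥0∞) ∂(μ : Measure X) := by
    intro μ
    rw [← lintegral_iSup (fun n => (h1 n).measurable)
      (fun m n hmn x => inf_le_inf_left _ (by exact_mod_cast hmn))]
    refine lintegral_congr fun x => ?_
    rw [← inf_iSup_eq, ENNReal.iSup_natCast, inf_top_eq]
  simp_rw [h2]
  refine lowerSemicontinuous_iSup fun n => lowerSemicontinuous_of_seq fun u μ hu => ?_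
  exact lintegral_le_liminf_of_lowerSemicontinuous (h1 n) (ENNReal.natCast_ne_top n)
    (fun x => inf_le_right) hu

lemma lowerSemicontinuous_lintegral_left {X Y : Type*} [TopologicalSpace X]
    [FirstCountableTopology X] [TopologicalSpace Y] [MeasurableSpace Y] [BorelSpace Y]
    {f : X → Y → ℝ≥0∞} (hf : LowerSemicontinuous fun z : X × Y => f z.1 z.2) (μ : Measure Y) :
    LowerSemicontinuous fun x => ∫⁻ y, f x y ∂μ := by
  have hm : ∀ x, Measurable (f x) := fun x =>
    (hf.comp (g := fun y : Y => (x, y)) (by fun_prop)).measurable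
  refine lowerSemicontinuous_of_seq fun u x hu => ?_
  refine le_trans (lintegral_mono fun y => ?_) (lintegral_liminf_le fun n => hm (u n))
  have h : Tendsto (fun n => (u n, y)) atTop (𝓝 (x, y)) := hu.prodMk_nhds tendsto_const_nhds
  exact (lowerSemicontinuousAt_iff_le_liminf.1 (hf (x, y))).trans
    (h.liminf_le_liminf_comp)

/-- A probability measure carried by the range of a continuous function on a compact space is
the image of a probability measure. -/
lemma exists_map_eq_of_compact {K X : Type*} [TopologicalSpace K] [CompactSpace K] [T2Space K]
    [MeasurableSpace K] [BorelSpace K] [MetricSpace X] [MeasurableSpace X] [BorelSpace X]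
    [SecondCountableTopology X] {f : K → X} (hf : Continuous f) (ν : Measure X)
    [IsProbabilityMeasure ν] (hν : ∀ᵐ x ∂ν, x ∈ range f) :
    ∃ μ : Measure K, IsProbabilityMeasure μ ∧ μ.map f = ν := by
  classical
  obtain ⟨_, k₀, rfl⟩ := hν.exists
  let F : ProbabilityMeasure K → ProbabilityMeasure X := fun μ => μ.map hf.measurable.aemeasurable
  have hF : Continuous F := ProbabilityMeasure.continuous_map hf
  have hcl : IsClosed (range F) := (isCompact_range hF).isClosed
  -- No measurable section of `f` is needed: the identity is approximated by simple functions valued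
  -- in the range, a simple function lifts by choosing one preimage per value, and the set of image
  -- laws is closed because it is compact.
  let a : ℕ → SimpleFunc X X := SimpleFunc.approxOn id measurable_id (range f) (f k₀) ⟨k₀, rfl⟩
  have ha : ∀ n x, a n x ∈ range f := fun n x => SimpleFunc.approxOn_mem _ _ _ _
  let g : X → K := fun x => if h : x ∈ range f then h.choose else k₀
  have hg : ∀ x ∈ range f, f (g x) = x := fun x hx => by
    simp only [g, dif_pos hx]; exact hx.choose_spec
  let ν' : ProbabilityMeasure X := ⟨ν, ‹_›⟩
  have hmem : ∀ n, ν'.map (a n).measurable.aemeasurable ∈ range F := by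
    intro n
    refine ⟨ν'.map ((a n).map g).measurable.aemeasurable, ?_⟩
    apply Subtype.ext
    change (ν.map ((a n).map g)).map f = ν.map (a n)
    rw [Measure.map_map hf.measurable ((a n).map g).measurable]
    congr 1
    ext x
    exact hg _ (ha n x)
  have hlim : Tendsto (fun n => ν'.map (a n).measurable.aemeasurable) atTop (𝓝 ν') := by
    rw [ProbabilityMeasure.tendsto_iff_forall_integral_tendsto]
    intro φ
    have h1 : ∀ n, ∫ x, φ x ∂(ν'.map (a n).measurable.aemeasurable : Measure X)
        = ∫ x, φ (a n x) ∂ν := fun n =>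
      integral_map (a n).measurable.aemeasurable φ.continuous.aestronglyMeasurable
    simp_rw [h1]
    refine tendsto_integral_of_dominated_convergence (fun _ => ‖φ‖)
      (fun n => (φ.continuous.measurable.comp (a n).measurable).aestronglyMeasurable)
      (integrable_const _) (fun n => Eventually.of_forall fun x => φ.norm_coe_le_norm _) ?_
    filter_upwards [hν] with x hx
    exact (φ.continuous.tendsto x).comp
      (SimpleFunc.tendsto_approxOn (f := id) measurable_id (mem_range_self k₀) (subset_closure hx))
  obtain ⟨μ, hμ⟩ := hcl.mem_of_tendsto hlim (Eventually.of_forall hmem)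
  exact ⟨μ, μ.2, congrArg Subtype.val hμ⟩

end Abstract

/-! ### First variation of the potential. -/

section Variation

set_option linter.unusedSectionVars false

variable {X : Type*} [TopologicalSpace X] [MeasurableSpace X] [BorelSpace X]

open Classical in
/-- The pair interaction `V`, set to zero on curves of infinite individual cost `c`. -/
def truncPair (c : X → ℝ≥0∞) (V : X → X → ℝ≥0∞) (x y : X) : ℝ≥0∞ :=
  if c x < ⊤ ∧ c y < ⊤ then V x y else 0

/-- `V` is not assumed measurable; only the sum with the individual costs is. Where these are finite
they can be subtracted, which is the reason for the truncation. -/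
lemma measurable_truncPair [SecondCountableTopology X] {c : X → ℝ≥0∞} {V : X → X → ℝ≥0∞}
    (hc : Measurable c)
    (hH : LowerSemicontinuous fun z : X × X => c z.1 + c z.2 + V z.1 z.2) :
    Measurable fun z : X × X => truncPair c V z.1 z.2 := by
  have hS : MeasurableSet {z : X × X | c z.1 < ⊤ ∧ c z.2 < ⊤} :=
    (measurableSet_lt (hc.comp measurable_fst) measurable_const).inter
      (measurableSet_lt (hc.comp measurable_snd) measurable_const)
  have h1 : Measurable fun z : X × X => c z.1 + c z.2 :=
    (hc.comp measurable_fst).add (hc.comp measurable_snd)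
  have : (fun z : X × X => truncPair c V z.1 z.2) =
      {z : X × X | c z.1 < ⊤ ∧ c z.2 < ⊤}.indicator
        (fun z => (c z.1 + c z.2 + V z.1 z.2) - (c z.1 + c z.2)) := by
    ext z
    by_cases hz : c z.1 < ⊤ ∧ c z.2 < ⊤
    · rw [indicator_of_mem (by exact hz), truncPair, if_pos hz,
        ENNReal.add_sub_cancel_left (ENNReal.add_lt_top.2 hz).ne]
    · rw [indicator_of_notMem (by exact hz), truncPair, if_neg hz]
  rw [this]
  exact (hH.measurable.sub h1).indicator hS

lemma lintegral_truncPair {c : X → ℝ≥0∞} {V : X → X → ℝ≥0∞} (hc : Measurable c) {Q : Measure X}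
    (hQ : ∫⁻ x, c x ∂Q < ⊤) {x : X} (hx : c x < ⊤) :
    ∫⁻ y, V x y ∂Q = ∫⁻ y, truncPair c V x y ∂Q := by
  refine lintegral_congr_ae ?_
  filter_upwards [ae_lt_top hc hQ.ne] with y hy
  rw [truncPair, if_pos ⟨hx, hy⟩]

/-- The cost of a single player facing the distribution `Q`. -/
def playerCost (c : X → ℝ≥0∞) (V : X → X → ℝ≥0∞) (Q : Measure X) (x : X) : ℝ≥0∞ :=
  c x + ∫⁻ y, V x y ∂Q

/-- The mutual interaction energy of two distributions. -/
def mutualEnergy (c : X → ℝ≥0∞) (V : X → X → ℝ≥0∞) (P Q : Measure X) : ℝ≥0∞ :=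
  ∫⁻ x, ∫⁻ y, truncPair c V x y ∂Q ∂P

/-- The potential whose minimizers are the equilibria. -/
def potential (c : X → ℝ≥0∞) (V : X → X → ℝ≥0∞) (Q : Measure X) : ℝ≥0∞ :=
  ∫⁻ z, c z.1 + c z.2 + V z.1 z.2 ∂(Q.prod Q)

variable {c : X → ℝ≥0∞} {V : X → X → ℝ≥0∞}

lemma lintegral_le_potential (hc : Measurable c) (Q : Measure X) [IsProbabilityMeasure Q] :
    ∫⁻ x, c x ∂Q ≤ potential c V Q := by
  calc ∫⁻ x, c x ∂Q = ∫⁻ z, c z.1 ∂(Q.prod Q) := by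
        rw [lintegral_prod _ (by fun_prop)]; simp
    _ ≤ _ := lintegral_mono fun z => by rw [add_assoc]; exact le_self_add

variable [SecondCountableTopology X]

lemma lintegral_playerCost (hc : Measurable c) {P Q : Measure X}
    (hP : ∫⁻ x, c x ∂P < ⊤) (hQ : ∫⁻ x, c x ∂Q < ⊤) :
    ∫⁻ x, playerCost c V Q x ∂P = ∫⁻ x, c x ∂P + mutualEnergy c V P Q := by
  simp only [playerCost, mutualEnergy]
  rw [lintegral_add_left hc]
  congr 1
  refine lintegral_congr_ae ?_
  filter_upwards [ae_lt_top hc hP.ne] with x hx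
  exact lintegral_truncPair hc hQ hx

/-- The individual cost counts twice and the interaction once, so that differentiating the quadratic
term produces exactly twice the player cost. -/
lemma potential_eq (hc : Measurable c)
    (hH : LowerSemicontinuous fun z : X × X => c z.1 + c z.2 + V z.1 z.2)
    {Q : Measure X} [IsProbabilityMeasure Q] (hQ : ∫⁻ x, c x ∂Q < ⊤) :
    potential c V Q = 2 * ∫⁻ x, c x ∂Q + mutualEnergy c V Q Q := by
  rw [potential, lintegral_add_left (by fun_prop)]
  congr 1
  · rw [lintegral_add_left (by fun_prop), lintegral_prod _ (by fun_prop),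
      lintegral_prod _ (by fun_prop)]
    simp [two_mul]
  · rw [mutualEnergy, lintegral_lintegral (measurable_truncPair hc hH).aemeasurable]
    refine lintegral_congr_ae ?_
    have h := ae_lt_top hc hQ.ne
    filter_upwards [Measure.quasiMeasurePreserving_fst.ae h,
      Measure.quasiMeasurePreserving_snd.ae h] with z h1 h2
    rw [truncPair, if_pos ⟨h1, h2⟩]

lemma mutualEnergy_comm (hc : Measurable c)
    (hH : LowerSemicontinuous fun z : X × X => c z.1 + c z.2 + V z.1 z.2)
    (hV : ∀ x y, V x y = V y x) (P Q : Measure X) [SFinite P] [SFinite Q] :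
    mutualEnergy c V P Q = mutualEnergy c V Q P := by
  rw [mutualEnergy, lintegral_lintegral_swap (measurable_truncPair hc hH).aemeasurable]
  refine lintegral_congr fun x => lintegral_congr fun y => ?_
  simp only [truncPair, hV x y, and_comm]

lemma mutualEnergy_lt_top (hc : Measurable c) {B : ℝ≥0∞} (hB : B ≠ ⊤)
    (hVB : ∀ x y, V x y ≤ B * (c x + c y)) {P Q : Measure X} [IsProbabilityMeasure P]
    [IsProbabilityMeasure Q] (hP : ∫⁻ x, c x ∂P < ⊤) (hQ : ∫⁻ x, c x ∂Q < ⊤) :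
    mutualEnergy c V P Q < ⊤ := by
  have h1 : mutualEnergy c V P Q ≤ ∫⁻ x, B * (c x + ∫⁻ y, c y ∂Q) ∂P := by
    refine lintegral_mono fun x => ?_
    calc ∫⁻ y, truncPair c V x y ∂Q ≤ ∫⁻ y, B * (c x + c y) ∂Q := lintegral_mono fun y => by
          rw [truncPair]; split_ifs
          · exact hVB x y
          · exact zero_le
      _ = _ := by
          rw [lintegral_const_mul' _ _ hB, lintegral_add_left measurable_const]; simp
  refine h1.trans_lt ?_
  rw [lintegral_const_mul' _ _ hB, lintegral_add_left hc]
  refine ENNReal.mul_lt_top hB.lt_top (ENNReal.add_lt_top.2 ⟨hP, ?_⟩)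
  simpa using hQ

lemma mutualEnergy_combination_left (a b : ℝ≥0∞) (P P' Q : Measure X) :
    mutualEnergy c V (a • P + b • P') Q =
      a * mutualEnergy c V P Q + b * mutualEnergy c V P' Q := by
  simp [mutualEnergy, lintegral_add_measure, lintegral_smul_measure]

/-- First order optimality condition for minimizers of the potential. -/
lemma lintegral_playerCost_le_of_isMin (hc : Measurable c)
    (hH : LowerSemicontinuous fun z : X × X => c z.1 + c z.2 + V z.1 z.2)
    (hV : ∀ x y, V x y = V y x) {B : ℝ≥0∞} (hB : B ≠ ⊤)
    (hVB : ∀ x y, V x y ≤ B * (c x + c y)) {Q Q' : Measure X} [IsProbabilityMeasure Q]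
    [IsProbabilityMeasure Q'] (hQ : ∫⁻ x, c x ∂Q < ⊤) (hQ' : ∫⁻ x, c x ∂Q' < ⊤)
    (hmin : ∀ t ∈ Ioo (0 : ℝ) 1, potential c V Q ≤
      potential c V (ENNReal.ofReal (1 - t) • Q + ENNReal.ofReal t • Q')) :
    ∫⁻ x, playerCost c V Q x ∂Q ≤ ∫⁻ x, playerCost c V Q x ∂Q' := by
  rw [lintegral_playerCost hc hQ hQ, lintegral_playerCost hc hQ' hQ]
  have e00 := mutualEnergy_lt_top hc hB hVB hQ hQ
  have e01 := mutualEnergy_lt_top hc hB hVB hQ' hQ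
  have e11 := mutualEnergy_lt_top hc hB hVB hQ' hQ'
  -- By bilinearity and symmetry the potential along the segment is a quadratic polynomial in t. All
  -- its coefficients are finite, so the rest is real arithmetic.
  have hmin' : ∀ t ∈ Ioo (0 : ℝ) 1,
      2 * ∫⁻ x, c x ∂Q + mutualEnergy c V Q Q ≤
      2 * (ENNReal.ofReal (1 - t) * ∫⁻ x, c x ∂Q + ENNReal.ofReal t * ∫⁻ x, c x ∂Q') +
        (ENNReal.ofReal (1 - t) * (ENNReal.ofReal (1 - t) * mutualEnergy c V Q Q +
            ENNReal.ofReal t * mutualEnergy c V Q' Q) +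
          ENNReal.ofReal t * (ENNReal.ofReal (1 - t) * mutualEnergy c V Q' Q +
            ENNReal.ofReal t * mutualEnergy c V Q' Q')) := by
    intro t ht
    have h1 := hmin t ht
    have hprob : IsProbabilityMeasure (ENNReal.ofReal (1 - t) • Q + ENNReal.ofReal t • Q') := by
      constructor
      simp only [Measure.coe_add, Measure.coe_smul, Pi.add_apply, Pi.smul_apply, measure_univ,
        smul_eq_mul, mul_one]
      rw [← ENNReal.ofReal_add (by linarith [ht.2]) ht.1.le]
      simp
    have hcint : ∫⁻ x, c x ∂(ENNReal.ofReal (1 - t) • Q + ENNReal.ofReal t • Q') =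
        ENNReal.ofReal (1 - t) * ∫⁻ x, c x ∂Q + ENNReal.ofReal t * ∫⁻ x, c x ∂Q' := by
      simp [lintegral_add_measure, lintegral_smul_measure]
    have hfin : ∫⁻ x, c x ∂(ENNReal.ofReal (1 - t) • Q + ENNReal.ofReal t • Q') < ⊤ := by
      rw [hcint]
      exact ENNReal.add_lt_top.2 ⟨ENNReal.mul_lt_top ENNReal.ofReal_lt_top hQ,
        ENNReal.mul_lt_top ENNReal.ofReal_lt_top hQ'⟩
    rw [potential_eq hc hH hQ, potential_eq hc hH hfin, hcint,
      mutualEnergy_combination_left,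
      mutualEnergy_comm hc hH hV Q (_ + _), mutualEnergy_comm hc hH hV Q' (_ + _),
      mutualEnergy_combination_left, mutualEnergy_combination_left,
      mutualEnergy_comm hc hH hV Q Q'] at h1
    exact h1
  clear hmin
  lift ∫⁻ x, c x ∂Q to NNReal using hQ.ne with a
  lift ∫⁻ x, c x ∂Q' to NNReal using hQ'.ne with b
  lift mutualEnergy c V Q Q to NNReal using e00.ne with m00
  lift mutualEnergy c V Q' Q to NNReal using e01.ne with m01
  lift mutualEnergy c V Q' Q' to NNReal using e11.ne with m11
  have hreal : ∀ t ∈ Ioo (0 : ℝ) 1, 2 * (a : ℝ) + m00 ≤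
      2 * ((1 - t) * a + t * b) + ((1 - t) * ((1 - t) * m00 + t * m01) +
        t * ((1 - t) * m01 + t * m11)) := by
    intro t ht
    have h1 := hmin' t ht
    have ht1 : 0 ≤ 1 - t := by linarith [ht.2]
    simp only [ENNReal.ofReal] at h1
    have h2 : 2 * a + m00 ≤ 2 * (Real.toNNReal (1 - t) * a + Real.toNNReal t * b) +
      (Real.toNNReal (1 - t) * (Real.toNNReal (1 - t) * m00 + Real.toNNReal t * m01) +
        Real.toNNReal t * (Real.toNNReal (1 - t) * m01 + Real.toNNReal t * m11)) := by
      exact_mod_cast h1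
    have h3 := NNReal.coe_le_coe.2 h2
    push_cast at h3
    rwa [Real.coe_toNNReal _ ht1, Real.coe_toNNReal _ ht.1.le] at h3
  norm_cast
  rw [← NNReal.coe_le_coe]
  push_cast
  by_contra hcon
  push Not at hcon
  set g : ℝ := a + m00 - (b + m01) with hg
  have hgpos : 0 < g := by rw [hg]; linarith
  set D : ℝ := (m00 : ℝ) - 2 * m01 + m11 with hD
  have hden : 0 < |D| + g + 1 := by positivity
  -- Minimality reads t (t D − 2 g) ≥ 0. This t is small enough that t D ≤ g, which is impossible
  -- when g > 0.
  have ht : g / (|D| + g + 1) ∈ Ioo (0 : ℝ) 1 :=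
    ⟨by positivity, (div_lt_one hden).2 (by linarith [abs_nonneg D])⟩
  have h1 := hreal _ ht
  set t := g / (|D| + g + 1)
  have h2 : 0 ≤ t * (t * D - 2 * g) := by rw [hD, hg]; nlinarith
  have h3 : t * D ≤ g := by
    calc t * D ≤ t * (|D| + g + 1) := by
          have := ht.1.le
          gcongr
          linarith [le_abs_self D]
      _ = g := div_mul_cancel₀ _ hden.ne'
  nlinarith [ht.1]

/-- Adding the constant ∫ c dQ turns the player cost into a partial integral of the lower
semicontinuous pair cost; the constant is finite and cancels. -/
lemma lowerSemicontinuous_playerCost [FirstCountableTopology X] (hc : LowerSemicontinuous c)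
    (hH : LowerSemicontinuous fun z : X × X => c z.1 + c z.2 + V z.1 z.2)
    {Q : Measure X} [IsProbabilityMeasure Q] (hQ : ∫⁻ x, c x ∂Q < ⊤) :
    LowerSemicontinuous (playerCost c V Q) := by
  have h1 := lowerSemicontinuous_lintegral_left (f := fun x y => c x + c y + V x y) hH Q
  have h2 : ∀ x, ∫⁻ y, (c x + c y + V x y) ∂Q = playerCost c V Q x + ∫⁻ y, c y ∂Q := by
    intro x
    rw [lintegral_add_left (by exact measurable_const.add hc.measurable),
      lintegral_add_left measurable_const, playerCost]
    simp only [lintegral_const, measure_univ, mul_one]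
    ring
  simp_rw [h2] at h1
  intro x y hy
  have h3 : y + ∫⁻ y, c y ∂Q < playerCost c V Q x + ∫⁻ y, c y ∂Q :=
    ENNReal.add_lt_add_of_lt_of_le hQ.ne hy le_rfl
  filter_upwards [h1 x _ h3] with x' hx'
  exact lt_of_add_lt_add_right hx'

end Variation

/-! ### Minimizers of the potential and equilibria. -/

section Existence

variable {X Y : Type*} [MetricSpace X] [SecondCountableTopology X]
  [MeasurableSpace X] [BorelSpace X] [MetricSpace Y] [CompleteSpace Y] [SecondCountableTopology Y]
  [MeasurableSpace Y] [BorelSpace Y] {e : X → Y} {c : X → ℝ≥0∞} {V : X → X → ℝ≥0∞}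

/-- The potential attains its minimum among the measures with prescribed initial law. -/
lemma exists_potential_minimizer (he : Continuous e) (hc : LowerSemicontinuous c)
    (hH : LowerSemicontinuous fun z : X × X => c z.1 + c z.2 + V z.1 z.2)
    (hcpt : ∀ C : Set Y, IsCompact C → ∀ M : ℝ≥0∞, M ≠ ⊤ →
      ∃ K : Set X, IsCompact K ∧ {x | e x ∈ C ∧ c x ≤ M} ⊆ K)
    (m₀ : Measure Y) [IsProbabilityMeasure m₀]
    (hfin : ∃ Q : Measure X, IsProbabilityMeasure Q ∧ Q.map e = m₀ ∧ potential c V Q < ⊤) :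
    ∃ Q : Measure X, IsProbabilityMeasure Q ∧ Q.map e = m₀ ∧ potential c V Q < ⊤ ∧
      ∀ Q' : Measure X, IsProbabilityMeasure Q' → Q'.map e = m₀ →
        potential c V Q ≤ potential c V Q' := by
  obtain ⟨Q₀, hQ₀, hQ₀e, hQ₀fin⟩ := hfin
  -- The added 1 keeps the level positive, so that it can be used in Markov's inequality below.
  obtain ⟨M, hM⟩ : ∃ M, M = potential c V Q₀ + 1 := ⟨_, rfl⟩
  have hM0 : M ≠ 0 := by simp [hM]
  have hMtop : M ≠ ⊤ := by simp [hM, hQ₀fin.ne]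
  have hQ₀M : potential c V Q₀ ≤ M := hM ▸ le_self_add
  let m : ProbabilityMeasure Y := ⟨m₀, ‹_›⟩
  let E : ProbabilityMeasure X → ProbabilityMeasure Y := fun μ => μ.map he.measurable.aemeasurable
  have hE : Continuous E := ProbabilityMeasure.continuous_map he
  let S : Set (ProbabilityMeasure X) := {Q | E Q = m ∧ ∫⁻ x, c x ∂(Q : Measure X) ≤ M}
  have htight : IsTightMeasureSet {((μ : ProbabilityMeasure X) : Measure X) | μ ∈ S} := by
    rw [isTightMeasureSet_iff_exists_isCompact_measure_compl_le]
    intro ε hε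
    wlog hεtop : ε ≠ ⊤ generalizing ε
    · push Not at hεtop
      exact ⟨∅, isCompact_empty, by simp [hεtop]⟩
    have hε2 : 0 < ε / 2 := ENNReal.half_pos hε.ne'
    have hε2t : ε / 2 ≠ ⊤ := (ENNReal.half_le_self.trans_lt hεtop.lt_top).ne
    obtain ⟨C, hC, hCm⟩ := isTightMeasureSet_iff_exists_isCompact_measure_compl_le.1
      (isTightMeasureSet_singleton (μ := m₀)) (ε / 2) hε2
    -- At this level Markov's inequality leaves mass at most ε/2 to the expensive curves; the other
    -- ε/2 is for those starting outside `C`.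
    obtain ⟨K, hK, hKsub⟩ := hcpt C hC (M / (ε / 2)) (ENNReal.div_lt_top hMtop hε2.ne').ne
    refine ⟨K, hK, ?_⟩
    rintro _ ⟨μ, ⟨hμe, hμc⟩, rfl⟩
    have h1 : Kᶜ ⊆ e ⁻¹' Cᶜ ∪ {x | M / (ε / 2) ≤ c x} := by
      intro x hx
      by_contra hcon
      simp only [mem_union, mem_preimage, mem_compl_iff, mem_ofPred_eq, not_or, not_not,
        not_le] at hcon
      exact hx (hKsub ⟨hcon.1, hcon.2.le⟩)
    have h2 : (μ : Measure X) (e ⁻¹' Cᶜ) ≤ ε / 2 := by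
      rw [← Measure.map_apply he.measurable hC.isClosed.measurableSet.compl]
      have : (μ : Measure X).map e = m₀ := congrArg Subtype.val hμe
      rw [this]
      exact hCm _ rfl
    have h3 : (μ : Measure X) {x | M / (ε / 2) ≤ c x} ≤ ε / 2 := by
      have hd : M / (ε / 2) ≠ 0 := (ENNReal.div_pos hM0 hε2t).ne'
      have hd' : M / (ε / 2) ≠ ⊤ := (ENNReal.div_lt_top hMtop hε2.ne').ne
      refine (meas_ge_le_lintegral_div hc.measurable.aemeasurable hd hd').trans ?_
      refine (ENNReal.div_le_div_right hμc _).trans ?_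
      rw [ENNReal.div_le_iff hd hd', ENNReal.mul_div_cancel hε2.ne' hε2t]
    calc (μ : Measure X) Kᶜ ≤ _ := measure_mono h1
      _ ≤ _ := measure_union_le _ _
      _ ≤ ε / 2 + ε / 2 := add_le_add h2 h3
      _ = ε := ENNReal.add_halves ε
  -- Prokhorov's theorem. Minimizing over the closure is harmless: the initial law is a closed
  -- condition, and every competitor of potential at most `M` lies in `S`.
  have hA : IsCompact (closure S ∩ E ⁻¹' {m}) :=
    (isCompact_closure_of_isTightMeasureSet htight).inter_right (isClosed_singleton.preimage hE)
  have hlsc : LowerSemicontinuous fun Q : ProbabilityMeasure X => potential c V (Q : Measure X) :=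
    (lowerSemicontinuous_lintegral_probabilityMeasure hH).comp
      (g := fun Q : ProbabilityMeasure X => Q.prod Q)
      (ProbabilityMeasure.continuous_prod.comp (continuous_id.prodMk continuous_id))
  have hQ₀S : (⟨Q₀, hQ₀⟩ : ProbabilityMeasure X) ∈ S :=
    ⟨Subtype.ext hQ₀e, (lintegral_le_potential hc.measurable Q₀).trans hQ₀M⟩
  have hne : (closure S ∩ E ⁻¹' {m}).Nonempty := ⟨_, subset_closure hQ₀S, hQ₀S.1⟩
  obtain ⟨Q, ⟨-, hQe⟩, hQmin⟩ := (hlsc.lowerSemicontinuousOn _).exists_isMinOn hne hA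
  have hQM : potential c V (Q : Measure X) ≤ potential c V Q₀ :=
    hQmin ⟨subset_closure hQ₀S, hQ₀S.1⟩
  refine ⟨Q, Q.2, congrArg Subtype.val hQe, hQM.trans_lt hQ₀fin, fun Q' hQ' hQ'e => ?_⟩
  by_cases h : potential c V Q' ≤ M
  · have hS : (⟨Q', hQ'⟩ : ProbabilityMeasure X) ∈ S :=
      ⟨Subtype.ext hQ'e, (lintegral_le_potential hc.measurable Q').trans h⟩
    exact hQmin ⟨subset_closure hS, hS.1⟩
  · exact (hQM.trans hQ₀M).trans (not_le.1 h).le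

/-- Existence of equilibria for potential games: minimizers of the potential are equilibria. -/
theorem exists_potential_equilibrium (he : Continuous e) (hc : LowerSemicontinuous c)
    (hH : LowerSemicontinuous fun z : X × X => c z.1 + c z.2 + V z.1 z.2)
    (hV : ∀ x y, V x y = V y x) {B : ℝ≥0∞} (hB : B ≠ ⊤)
    (hVB : ∀ x y, V x y ≤ B * (c x + c y))
    (hcpt : ∀ C : Set Y, IsCompact C → ∀ M : ℝ≥0∞, M ≠ ⊤ →
      ∃ K : Set X, IsCompact K ∧ {x | e x ∈ C ∧ c x ≤ M} ⊆ K)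
    (m₀ : Measure Y) [IsProbabilityMeasure m₀]
    (hfin : ∃ Q : Measure X, IsProbabilityMeasure Q ∧ Q.map e = m₀ ∧ ∫⁻ x, c x ∂Q < ⊤)
    (hlift : ∀ Q : Measure X, IsProbabilityMeasure Q → ∫⁻ x, c x ∂Q < ⊤ → ∀ (ω : X) (m : ℝ≥0∞),
      playerCost c V Q ω < m → ∃ r > 0, ∀ ν : Measure Y, IsProbabilityMeasure ν →
        (∀ᵐ y ∂ν, dist y (e ω) < r) → ∃ μ : Measure X, IsProbabilityMeasure μ ∧ μ.map e = ν ∧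
          ∀ᵐ x ∂μ, playerCost c V Q x ≤ m) :
    ∃ Q : Measure X, IsProbabilityMeasure Q ∧ Q.map e = m₀ ∧ ∫⁻ x, c x ∂Q < ⊤ ∧
      ∫⁻ x, playerCost c V Q x ∂Q < ⊤ ∧
      ∀ x ∈ Q.support, ∀ ω, e ω = e x → playerCost c V Q x ≤ playerCost c V Q ω := by
  have hcm := hc.measurable
  obtain ⟨Q, hQp, hQe, hQfin, hQmin⟩ := exists_potential_minimizer he hc hH hcpt m₀ (by
    obtain ⟨Q, hQ, hQe, hQc⟩ := hfin
    refine ⟨Q, hQ, hQe, ?_⟩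
    rw [potential_eq hcm hH hQc]
    exact ENNReal.add_lt_top.2 ⟨ENNReal.mul_lt_top (by simp) hQc,
      mutualEnergy_lt_top hcm hB hVB hQc hQc⟩)
  have hQc : ∫⁻ x, c x ∂Q < ⊤ := (lintegral_le_potential hcm Q).trans_lt hQfin
  have hQF : ∫⁻ x, playerCost c V Q x ∂Q < ⊤ := by
    rw [lintegral_playerCost hcm hQc hQc]
    exact ENNReal.add_lt_top.2 ⟨hQc, mutualEnergy_lt_top hcm hB hVB hQc hQc⟩
  refine ⟨Q, hQp, hQe, hQc, hQF, fun x hx ω hω => ?_⟩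
  by_contra hcon
  push Not at hcon
  -- Two levels separate the costs: the substitutes of `ω` will cost at most `m₁`, the curves
  -- removed near `x` more than `m₂`.
  obtain ⟨m₁, hm₁, hm₁'⟩ := exists_between hcon
  obtain ⟨m₂, hm₂, hm₂'⟩ := exists_between hm₁'
  obtain ⟨r, hr, hlift⟩ := hlift Q hQp hQc ω m₁ hm₁
  have hlsc := lowerSemicontinuous_playerCost hc hH hQc
  set U : Set X := {z | m₂ < playerCost c V Q z} ∩ e ⁻¹' Metric.ball (e ω) r with hU
  have hUo : IsOpen U := (hlsc.isOpen_preimage m₂).inter (Metric.isOpen_ball.preimage he)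
  have hxU : x ∈ U := ⟨hm₂', by simpa [hω] using hr⟩
  have hUpos : 0 < Q U := (Measure.mem_support_iff_forall x).1 hx U (hUo.mem_nhds hxU)
  have hUtop : Q U ≠ ⊤ := measure_ne_top _ _
  have hcond : IsProbabilityMeasure ((Q U)⁻¹ • Q.restrict U) := by
    constructor
    simp [ENNReal.inv_mul_cancel hUpos.ne' hUtop]
  obtain ⟨μ, hμp, hμe, hμF⟩ := hlift (((Q U)⁻¹ • Q.restrict U).map e)
    (Measure.isProbabilityMeasure_map he.measurable.aemeasurable) (by
      rw [ae_map_iff he.measurable.aemeasurable (by exact measurableSet_lt (by fun_prop) (by fun_prop))]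
      refine Measure.ae_smul_measure ?_ _
      filter_upwards [ae_restrict_mem hUo.measurableSet] with z hz using hz.2)
  -- The mass on `U` is replaced by cheap curves; `μ` has the initial law of `Q` conditioned on `U`,
  -- so the total initial law is unchanged.
  set Q' : Measure X := Q.restrict Uᶜ + Q U • μ with hQ'
  have hQ'p : IsProbabilityMeasure Q' := by
    constructor
    rw [hQ']
    simp only [Measure.coe_add, Measure.coe_smul, Pi.add_apply, Pi.smul_apply, measure_univ,
      smul_eq_mul, mul_one, Measure.restrict_apply_univ]
    rw [add_comm, measure_add_measure_compl hUo.measurableSet, measure_univ]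
  have hQ'e : Q'.map e = m₀ := by
    rw [hQ', Measure.map_add _ _ he.measurable, Measure.map_smul, hμe, Measure.map_smul, smul_smul,
      ENNReal.mul_inv_cancel hUpos.ne' hUtop, one_smul, ← Measure.map_add _ _ he.measurable,
      add_comm, Measure.restrict_add_restrict_compl hUo.measurableSet, hQe]
  have hμm : ∫⁻ z, playerCost c V Q z ∂μ ≤ m₁ := by
    simpa using lintegral_mono_ae hμF
  have hQ'c : ∫⁻ z, c z ∂Q' < ⊤ := by
    rw [hQ', lintegral_add_measure, lintegral_smul_measure]
    refine ENNReal.add_lt_top.2 ⟨(setLIntegral_le_lintegral _ _).trans_lt hQc,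
      ENNReal.mul_lt_top hUtop.lt_top ?_⟩
    refine lt_of_le_of_lt (lintegral_mono fun z => ?_) (hμm.trans_lt hm₁'.lt_top)
    exact le_self_add
  have hvar := lintegral_playerCost_le_of_isMin hcm hH hV hB hVB hQc hQ'c (fun t ht => by
    refine hQmin _ ?_ ?_
    · constructor
      simp only [Measure.coe_add, Measure.coe_smul, Pi.add_apply, Pi.smul_apply, measure_univ,
        smul_eq_mul, mul_one]
      rw [← ENNReal.ofReal_add (by linarith [ht.2]) ht.1.le]
      simp
    · rw [Measure.map_add _ _ he.measurable, Measure.map_smul, Measure.map_smul, hQe, hQ'e,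
        ← add_smul, ← ENNReal.ofReal_add (by linarith [ht.2]) ht.1.le]
      simp)
  -- The part outside `U` is common and finite. Cancelling it leaves m₂ Q(U) ≤ m₁ Q(U), a
  -- contradiction.
  rw [← lintegral_add_compl _ hUo.measurableSet, hQ', lintegral_add_measure,
    lintegral_smul_measure, add_comm] at hvar
  have hcompl : ∫⁻ z in Uᶜ, playerCost c V Q z ∂Q ≠ ⊤ :=
    ((setLIntegral_le_lintegral _ _).trans_lt hQF).ne
  have h1 : ∫⁻ z in U, playerCost c V Q z ∂Q ≤ Q U • ∫⁻ z, playerCost c V Q z ∂μ :=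
    (ENNReal.add_le_add_iff_left hcompl).1 hvar
  have h2 : m₂ * Q U ≤ ∫⁻ z in U, playerCost c V Q z ∂Q := by
    rw [← setLIntegral_const]
    exact setLIntegral_mono' hUo.measurableSet fun z hz => hz.1.le
  have h3 : m₂ * Q U ≤ m₁ * Q U :=
    h2.trans (h1.trans (by rw [smul_eq_mul, mul_comm]; gcongr))
  exact absurd ((ENNReal.mul_le_mul_iff_left hUpos.ne' hUtop).1 h3) (not_le.2 hm₂)

end Existence

/-! ### Weighted energies on the Hilbert space of velocities. -/

section Velocity

variable {d : ℕ} {T : ℝ}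

/-- The space of square integrable velocities on `[0,T]`. -/
abbrev Vel (d : ℕ) (T : ℝ) : Type := Lp (Vec d) 2 (volume.restrict (Icc (0 : ℝ) T))

/-- Constant extension to the real line of a continuous weight on `[0,T]`. -/
def extendWeight (hT : 0 < T) (φ : C(Icc (0 : ℝ) T, ℝ)) : BoundedContinuousFunction ℝ ℝ :=
  (BoundedContinuousFunction.mkOfCompact φ).compContinuous
    ⟨projIcc 0 T hT.le, continuous_projIcc⟩

lemma continuous_extendWeight (hT : 0 < T) :
    Continuous (extendWeight hT) :=
  (BoundedContinuousFunction.continuous_compContinuous _).comp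
    (ContinuousMap.isometryEquivBoundedOfCompact (Icc (0 : ℝ) T) ℝ).continuous

/-- Multiplication of velocities by a continuous weight. -/
def weightOp (hT : 0 < T) (φ : C(Icc (0 : ℝ) T, ℝ)) : Vel d T →L[ℝ] Vel d T :=
  (ContinuousLinearMap.lsmul ℝ ℝ : ℝ →L[ℝ] Vec d →L[ℝ] Vec d).holderL
    (volume.restrict (Icc (0 : ℝ) T)) ⊤ 2 2
    (BoundedContinuousFunction.toLp ⊤ (volume.restrict (Icc (0 : ℝ) T)) ℝ (extendWeight hT φ))

/-- Uniform convergence of weights becomes convergence in operator norm, so weights and velocities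
can vary together. -/
lemma continuous_weightOp (hT : 0 < T) :
    Continuous (weightOp (d := d) hT) :=
  (ContinuousLinearMap.continuous _).comp
    ((ContinuousLinearMap.continuous _).comp (continuous_extendWeight hT))

lemma weightOp_ae (hT : 0 < T) (φ : C(Icc (0 : ℝ) T, ℝ)) (u : Vel d T) :
    weightOp hT φ u =ᵐ[volume.restrict (Icc (0 : ℝ) T)]
      fun t => φ (projIcc 0 T hT.le t) • u t := by
  have h1 := BoundedContinuousFunction.coeFn_toLp ⊤ (volume.restrict (Icc (0 : ℝ) T)) ℝ
    (extendWeight hT φ)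
  have h2 := (ContinuousLinearMap.lsmul ℝ ℝ : ℝ →L[ℝ] Vec d →L[ℝ] Vec d).coeFn_holder (r := 2)
    (BoundedContinuousFunction.toLp ⊤ (volume.restrict (Icc (0 : ℝ) T)) ℝ (extendWeight hT φ)) u
  filter_upwards [h1, h2] with t h1 h2
  rw [weightOp, ContinuousLinearMap.holderL_apply_apply, h2, h1]
  rfl

lemma inner_weightOp (hT : 0 < T) (φ : C(Icc (0 : ℝ) T, ℝ)) (u v : Vel d T) :
    ⟪u, weightOp hT φ v⟫ =
      ∫ t in Icc (0 : ℝ) T, φ (projIcc 0 T hT.le t) * ⟪u t, v t⟫ := by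
  rw [L2.inner_def]
  refine integral_congr_ae ?_
  filter_upwards [weightOp_ae hT φ v] with t ht
  rw [ht, inner_smul_right]

lemma inner_weightOp_comm (hT : 0 < T) (φ : C(Icc (0 : ℝ) T, ℝ)) (u v : Vel d T) :
    ⟪u, weightOp hT φ v⟫ = ⟪v, weightOp hT φ u⟫ := by
  simp only [inner_weightOp, real_inner_comm]

/-- The weighted energy `∫ φ |u|²` of a velocity. -/
def weightedEnergy (hT : 0 < T) (φ : C(Icc (0 : ℝ) T, ℝ)) (u : Vel d T) : ℝ :=
  ⟪u, weightOp hT φ u⟫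

lemma weightedEnergy_nonneg (hT : 0 < T) {φ : C(Icc (0 : ℝ) T, ℝ)} (hφ : ∀ t, 0 ≤ φ t)
    (u : Vel d T) : 0 ≤ weightedEnergy hT φ u := by
  rw [weightedEnergy, inner_weightOp]
  exact integral_nonneg fun t => mul_nonneg (hφ _) real_inner_self_nonneg

lemma weightedEnergy_neg (hT : 0 < T) (φ : C(Icc (0 : ℝ) T, ℝ)) (u : Vel d T) :
    weightedEnergy hT φ (-u) = weightedEnergy hT φ u := by
  simp [weightedEnergy]

lemma integrable_weighted (hT : 0 < T) (φ : C(Icc (0 : ℝ) T, ℝ)) (u : Vel d T) :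
    Integrable (fun t => φ (projIcc 0 T hT.le t) * ⟪u t, u t⟫)
      (volume.restrict (Icc (0 : ℝ) T)) := by
  refine (L2.integrable_inner (𝕜 := ℝ) u (weightOp hT φ u)).congr ?_
  filter_upwards [weightOp_ae hT φ u] with t ht
  rw [ht, inner_smul_right]

lemma weightedEnergy_le (hT : 0 < T) {φ : C(Icc (0 : ℝ) T, ℝ)} {C : ℝ} (hφ : ∀ t, φ t ≤ C)
    (u : Vel d T) : weightedEnergy hT φ u ≤ C * ‖u‖ ^ 2 := by
  rw [weightedEnergy, inner_weightOp, ← real_inner_self_eq_norm_sq, L2.inner_def,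
    ← integral_const_mul]
  exact integral_mono (integrable_weighted hT φ u) ((L2.integrable_inner u u).const_mul C)
    fun t => mul_le_mul_of_nonneg_right (hφ _) real_inner_self_nonneg

lemma lintegral_weighted (hT : 0 < T) {φ : C(Icc (0 : ℝ) T, ℝ)} (hφ : ∀ t, 0 ≤ φ t)
    (u : Vel d T) :
    ∫⁻ t : Icc (0 : ℝ) T, ‖u t‖ₑ ^ 2 * ENNReal.ofReal (φ t) ∂(volume.comap Subtype.val) =
      ENNReal.ofReal (weightedEnergy hT φ u) := by
  have h1 : ∀ t : Icc (0 : ℝ) T, ‖u t‖ₑ ^ 2 * ENNReal.ofReal (φ t) =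
      ENNReal.ofReal (φ (projIcc 0 T hT.le t) * ⟪u t, u t⟫) := by
    intro t
    rw [projIcc_val, ENNReal.ofReal_mul (hφ _), real_inner_self_eq_norm_sq,
      ENNReal.ofReal_pow (norm_nonneg _), ofReal_norm, mul_comm]
  simp_rw [h1]
  rw [lintegral_subtype_comap measurableSet_Icc
      (fun t => ENNReal.ofReal (φ (projIcc 0 T hT.le t) * ⟪u t, u t⟫)),
    weightedEnergy, inner_weightOp,
    ofReal_integral_eq_lintegral_ofReal (integrable_weighted hT φ u)
      (Eventually.of_forall fun t => mul_nonneg (hφ _) real_inner_self_nonneg)]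

lemma lintegral_enorm_sq (u : Vel d T) :
    ∫⁻ t in Icc (0 : ℝ) T, ‖u t‖ₑ ^ 2 = ENNReal.ofReal (‖u‖ ^ 2) := by
  rw [← real_inner_self_eq_norm_sq, L2.inner_def, ofReal_integral_eq_lintegral_ofReal
    (L2.integrable_inner u u) (Eventually.of_forall fun t => real_inner_self_nonneg)]
  refine lintegral_congr fun t => ?_
  rw [real_inner_self_eq_norm_sq, ENNReal.ofReal_pow (norm_nonneg _), ofReal_norm]

lemma tendsto_inner_apply {H : Type*} [NormedAddCommGroup H] [InnerProductSpace ℝ H]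
    {ι : Type*} {l : Filter ι} {A : ι → H →L[ℝ] H} {A₀ : H →L[ℝ] H} {u : ι → H} {u₀ : H}
    (hA : Tendsto A l (𝓝 A₀)) (hu : Tendsto u l (𝓝 u₀)) :
    Tendsto (fun i => ⟪u i, A i (u i)⟫) l (𝓝 ⟪u₀, A₀ u₀⟫) :=
  hu.inner ((isBoundedBilinearMap_apply.continuous.tendsto (A₀, u₀)).comp (hA.prodMk_nhds hu))

lemma tendsto_weightedEnergy (hT : 0 < T) {ι : Type*} {l : Filter ι}
    {φ : ι → C(Icc (0 : ℝ) T, ℝ)} {φ₀ : C(Icc (0 : ℝ) T, ℝ)} {u : ι → Vel d T} {u₀ : Vel d T}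
    (hφ : Tendsto φ l (𝓝 φ₀)) (hu : Tendsto u l (𝓝 u₀)) :
    Tendsto (fun i => weightedEnergy hT (φ i) (u i)) l (𝓝 (weightedEnergy hT φ₀ u₀)) := by
  have h : Tendsto (fun i => weightOp (d := d) hT (φ i)) l (𝓝 (weightOp hT φ₀)) :=
    ((continuous_weightOp hT).tendsto _).comp hφ
  exact tendsto_inner_apply h hu

lemma inner_apply_le_of_norm_le {H : Type*} [NormedAddCommGroup H] [InnerProductSpace ℝ H]
    (A : H →L[ℝ] H) {u : H} {R : ℝ} (hu : ‖u‖ ≤ R) : ⟪u, A u⟫ ≤ ‖A‖ * R ^ 2 := by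
  calc ⟪u, A u⟫ ≤ ‖u‖ * ‖A u‖ := real_inner_le_norm _ _
    _ ≤ ‖u‖ * (‖A‖ * ‖u‖) := by gcongr; exact A.le_opNorm u
    _ = ‖A‖ * ‖u‖ ^ 2 := by ring
    _ ≤ ‖A‖ * R ^ 2 := by gcongr

/-- The weighted energy is lower semicontinuous along weakly converging bounded velocities and
uniformly converging weights. -/
lemma weightedEnergy_le_of_weak (hT : 0 < T) {ι : Type*} {l : Filter ι} [l.NeBot]
    {φ : ι → C(Icc (0 : ℝ) T, ℝ)} {φ₀ : C(Icc (0 : ℝ) T, ℝ)} {u : ι → Vel d T} {u₀ : Vel d T}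
    (hφ : Tendsto φ l (𝓝 φ₀)) (hφ₀ : ∀ t, 0 ≤ φ₀ t) {R : ℝ} (hR : ∀ᶠ i in l, ‖u i‖ ≤ R)
    (hu : ∀ g, Tendsto (fun i => ⟪g, u i⟫) l (𝓝 ⟪g, u₀⟫)) {ℓ : ℝ}
    (hℓ : Tendsto (fun i => weightedEnergy hT (φ i) (u i)) l (𝓝 ℓ)) :
    weightedEnergy hT φ₀ u₀ ≤ ℓ := by
  -- A convex quadratic form lies above its tangent at `u₀`, which is weakly continuous. The last
  -- term bounds the error of replacing the weight `φ i` by `φ₀` on velocities of norm at most `R`.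
  have h1 : Tendsto (fun i => 2 * ⟪weightOp hT φ₀ u₀, u i⟫ - weightedEnergy hT φ₀ u₀
      - ‖weightOp (d := d) hT φ₀ - weightOp hT (φ i)‖ * R ^ 2) l
      (𝓝 (2 * ⟪weightOp hT φ₀ u₀, u₀⟫ - weightedEnergy hT φ₀ u₀ - 0 * R ^ 2)) := by
    refine (((hu _).const_mul 2).sub_const _).sub (Tendsto.mul_const _ ?_)
    have := (tendsto_const_nhds (x := weightOp (d := d) hT φ₀)).sub
      (((continuous_weightOp (d := d) hT).tendsto _).comp hφ)
    simpa using this.norm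
  have h2 : weightedEnergy hT φ₀ u₀ =
      2 * ⟪weightOp hT φ₀ u₀, u₀⟫ - weightedEnergy hT φ₀ u₀ - 0 * R ^ 2 := by
    rw [real_inner_comm, weightedEnergy]; ring
  rw [h2]
  refine le_of_tendsto_of_tendsto h1 hℓ ?_
  filter_upwards [hR] with i hi
  have h3 : 0 ≤ weightedEnergy hT φ₀ (u i - u₀) := weightedEnergy_nonneg hT hφ₀ _
  have h4 : weightedEnergy hT φ₀ (u i - u₀) = weightedEnergy hT φ₀ (u i)
      - 2 * ⟪weightOp hT φ₀ u₀, u i⟫ + weightedEnergy hT φ₀ u₀ := by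
    simp only [weightedEnergy, map_sub, inner_sub_left, inner_sub_right]
    rw [inner_weightOp_comm hT φ₀ u₀ (u i), real_inner_comm (u i) (weightOp hT φ₀ u₀)]
    ring
  have h5 : weightedEnergy hT φ₀ (u i) - weightedEnergy hT (φ i) (u i) ≤
      ‖weightOp (d := d) hT φ₀ - weightOp hT (φ i)‖ * R ^ 2 := by
    have h6 := inner_apply_le_of_norm_le (weightOp hT φ₀ - weightOp hT (φ i)) hi
    rwa [sub_apply, inner_sub_right] at h6
  linarith

/-- Bounded families in a Hilbert space converge weakly along ultrafilters. -/
lemma exists_weak_limit {H : Type*} [NormedAddCommGroup H] [InnerProductSpace ℝ H]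
    [CompleteSpace H] {ι : Type*} (l : Ultrafilter ι) {u : ι → H} {R : ℝ}
    (hR : ∀ᶠ i in l, ‖u i‖ ≤ R) :
    ∃ u₀ : H, ∀ g, Tendsto (fun i => ⟪g, u i⟫) l (𝓝 ⟪g, u₀⟫) := by
  -- Banach–Alaoglu in the dual, carried back by the Riesz isomorphism.
  let F : ι → WeakDual ℝ H := fun i =>
    StrongDual.toWeakDual (InnerProductSpace.toDual ℝ H (u i))
  have hc := WeakDual.isCompact_closedBall (𝕜 := ℝ) (E := H) 0 R
  obtain ⟨L, -, hL⟩ := hc.ultrafilter_le_nhds' (l.map F) (by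
    rw [Ultrafilter.mem_map]
    filter_upwards [hR] with i hi
    simp only [F, mem_preimage, Metric.mem_closedBall, dist_zero_right]
    exact ((InnerProductSpace.toDual ℝ H).norm_map (u i)).trans_le hi)
  have hL' : Tendsto F l (𝓝 L) := hL
  refine ⟨(InnerProductSpace.toDual ℝ H).symm (WeakDual.toStrongDual L), fun g => ?_⟩
  have h1 := ((WeakDual.eval_continuous g).tendsto L).comp hL'
  rw [real_inner_comm, InnerProductSpace.toDual_symm_apply]
  refine h1.congr fun i => ?_
  rw [real_inner_comm]
  exact InnerProductSpace.toDual_apply_apply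

end Velocity

/-! ### Velocities of curves in the ambient group. -/

section Projection

variable {d : ℕ} {T : ℝ} {G : Type} [NormedAddCommGroup G] {p : Vec d → G}

/-- An additive contraction with discrete kernel, such as the identity of `ℝ^d` or the projection
onto the torus. -/
structure IsProjection (p : Vec d → G) : Prop where
  map_add : ∀ x y, p (x + y) = p x + p y
  norm_le : ∀ x, ‖p x‖ ≤ ‖x‖
  discrete : ∃ ρ > 0, ∀ x, p x = 0 → ‖x‖ < ρ → x = 0

namespace IsProjection

lemma map_zero (hp : IsProjection p) : p 0 = 0 := by
  simpa using hp.map_add 0 0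

lemma map_neg (hp : IsProjection p) (x : Vec d) : p (-x) = -p x := by
  rw [eq_neg_iff_add_eq_zero, ← hp.map_add, neg_add_cancel, hp.map_zero]

lemma map_sub (hp : IsProjection p) (x y : Vec d) : p (x - y) = p x - p y := by
  rw [sub_eq_add_neg, hp.map_add, hp.map_neg, sub_eq_add_neg]

lemma continuous (hp : IsProjection p) : Continuous p := by
  refine LipschitzWith.continuous (K := 1) (LipschitzWith.of_dist_le_mul fun x y => ?_)
  rw [dist_eq_norm, dist_eq_norm, ← hp.map_sub]
  simpa using hp.norm_le (x - y)

end IsProjection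

lemma intervalIntegrable_of_memLp {v : ℝ → Vec d} (hv : MemLp v 2 (volume.restrict (Icc 0 T)))
    (s t : Icc (0 : ℝ) T) : IntervalIntegrable v volume s t := by
  have h1 : IntegrableOn v (Icc 0 T) := hv.integrable (by norm_num)
  exact (h1.mono_set (ordConnected_Icc.uIcc_subset s.2 t.2)).intervalIntegrable

lemma intervalIntegral_congr_restrict {v v' : ℝ → Vec d}
    (h : v =ᵐ[volume.restrict (Icc 0 T)] v') (s t : Icc (0 : ℝ) T) :
    ∫ r in (s : ℝ)..t, v r = ∫ r in (s : ℝ)..t, v' r := by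
  refine intervalIntegral.integral_congr_ae ?_
  rw [EventuallyEq, ae_restrict_iff' measurableSet_Icc] at h
  filter_upwards [h] with r hr hrs
  exact hr (ordConnected_Icc.uIcc_subset s.2 t.2 (uIoc_subset_uIcc hrs))

lemma IsVelocity.congr {w : Icc (0 : ℝ) T → G} {v v' : ℝ → Vec d} (h : IsVelocity p w v)
    (hv : v =ᵐ[volume.restrict (Icc 0 T)] v') : IsVelocity p w v' :=
  ⟨h.1.ae_eq hv, fun s t => by rw [h.2 s t, intervalIntegral_congr_restrict hv]⟩

lemma IsVelocity.toLp {w : Icc (0 : ℝ) T → G} {v : ℝ → Vec d} (h : IsVelocity p w v) :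
    IsVelocity p w (h.1.toLp v : Vel d T) :=
  h.congr h.1.coeFn_toLp.symm

lemma MemH1.exists_vel {w : Icc (0 : ℝ) T → G} (h : MemH1 p w) :
    ∃ u : Vel d T, IsVelocity p w u :=
  let ⟨_, hv⟩ := h
  ⟨_, hv.toLp⟩

lemma IsVelocity.sub (hp : IsProjection p) {w w' : Icc (0 : ℝ) T → G} {u u' : Vel d T}
    (h : IsVelocity p w u) (h' : IsVelocity p w' u') :
    IsVelocity p (fun t => w t - w' t) (u - u' : Vel d T) := by
  refine ⟨Lp.memLp _, fun s t => ?_⟩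
  rw [intervalIntegral_congr_restrict (Lp.coeFn_sub u u')]
  simp only [Pi.sub_apply]
  rw [intervalIntegral.integral_sub (intervalIntegrable_of_memLp h.1 s t)
    (intervalIntegrable_of_memLp h'.1 s t), hp.map_sub, ← h.2, ← h'.2]
  abel

lemma IsVelocity.neg (hp : IsProjection p) {w : Icc (0 : ℝ) T → G} {u : Vel d T}
    (h : IsVelocity p w u) : IsVelocity p (fun t => -w t) (-u : Vel d T) := by
  refine ⟨Lp.memLp _, fun s t => ?_⟩
  rw [intervalIntegral_congr_restrict (Lp.coeFn_neg u)]
  simp only [Pi.neg_apply]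
  rw [intervalIntegral.integral_neg, hp.map_neg, ← h.2]
  abel

/-- The velocity of a curve is unique up to a null set of times. -/
lemma IsVelocity.ae_eq (hT : 0 < T) (hp : IsProjection p) {w : Icc (0 : ℝ) T → G}
    {v v' : ℝ → Vec d} (h : IsVelocity p w v) (h' : IsVelocity p w v') :
    v =ᵐ[volume.restrict (Icc 0 T)] v' := by
  obtain ⟨ρ, hρ, hker⟩ := hp.discrete
  let z : Icc (0 : ℝ) T := ⟨0, left_mem_Icc.2 hT.le⟩
  let e : Icc (0 : ℝ) T := ⟨T, right_mem_Icc.2 hT.le⟩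
  set u : ℝ → Vec d := fun r => v r - v' r with hu
  have hint : IntervalIntegrable u volume 0 T :=
    (intervalIntegrable_of_memLp h.1 z e).sub (intervalIntegrable_of_memLp h'.1 z e)
  set g : ℝ → Vec d := fun t => ∫ r in (0 : ℝ)..t, u r with hg
  have hgc : ContinuousOn g (Icc 0 T) := by
    have := intervalIntegral.continuousOn_primitive_interval (μ := volume) (f := u) (a := 0)
      (b := T) (by rw [uIcc_of_le hT.le]; exact (intervalIntegrable_iff_integrableOn_Icc_of_le hT.le).1 hint)
    rwa [uIcc_of_le hT.le] at this
  have hpg : ∀ t ∈ Icc (0 : ℝ) T, p (g t) = 0 := by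
    intro t ht
    have h1 := h.2 z ⟨t, ht⟩
    have h2 := h'.2 z ⟨t, ht⟩
    simp only [hg, hu]
    rw [intervalIntegral.integral_sub (intervalIntegrable_of_memLp h.1 z ⟨t, ht⟩)
      (intervalIntegrable_of_memLp h'.1 z ⟨t, ht⟩), hp.map_sub]
    exact sub_eq_zero.2 (h1.symm.trans h2)
  -- The primitive `g` of the difference is continuous, starts at 0 and stays in the kernel of `p`.
  -- If it reached norm ρ it would cross norm ρ/2, which discreteness of the kernel excludes.
  have hg0 : ∀ t ∈ Icc (0 : ℝ) T, g t = 0 := by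
    intro t ht
    refine hker _ (hpg t ht) ?_
    by_contra hcon
    push Not at hcon
    have hivt := intermediate_value_Icc ht.1
      (hgc.norm.mono (Icc_subset_Icc_right ht.2))
    obtain ⟨s, hs, hs'⟩ := hivt (show ρ / 2 ∈ Icc ‖g 0‖ ‖g t‖ by
      refine ⟨?_, by linarith⟩
      simp [hg]; linarith)
    have hs'' : ‖g s‖ = ρ / 2 := hs'
    have := hker _ (hpg s ⟨hs.1, hs.2.trans ht.2⟩) (by linarith)
    rw [this, norm_zero] at hs''
    linarith
  -- Lebesgue differentiation: at almost every time the derivative of the vanishing primitive is the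
  -- difference of the velocities.
  have hae := hint.ae_hasDerivAt_integral
  rw [← Measure.restrict_congr_set (Ioo_ae_eq_Icc (a := (0 : ℝ)) (b := T)), EventuallyEq,
    ae_restrict_iff' measurableSet_Ioo]
  filter_upwards [hae] with r hr hrI
  have h1 : HasDerivAt g (u r) r :=
    hr (by rw [uIcc_of_le hT.le]; exact Ioo_subset_Icc_self hrI) 0 left_mem_uIcc
  have h2 : HasDerivAt g 0 r := by
    refine (hasDerivAt_const r (0 : Vec d)).congr_of_eventuallyEq ?_
    filter_upwards [Ioo_mem_nhds hrI.1 hrI.2] with t ht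
    exact hg0 t (Ioo_subset_Icc_self ht)
  exact sub_eq_zero.1 (h1.unique h2)

lemma intervalIntegral_eq_sub (u : Vel d T) (s t : Icc (0 : ℝ) T) :
    ∫ r in (s : ℝ)..t, u r =
      (∫ r in Ioc (s : ℝ) t, u r ∂(volume.restrict (Icc 0 T))) -
        ∫ r in Ioc (t : ℝ) s, u r ∂(volume.restrict (Icc 0 T)) := by
  have h : ∀ a b : Icc (0 : ℝ) T, (volume.restrict (Icc 0 T)).restrict (Ioc (a : ℝ) b) =
      volume.restrict (Ioc (a : ℝ) b) := fun a b => by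
    rw [Measure.restrict_restrict measurableSet_Ioc, inter_eq_left.2]
    exact Ioc_subset_Icc_self.trans (Icc_subset_Icc a.2.1 b.2.2)
  rw [h, h]
  rfl

/-- Increments are continuous for the weak convergence of velocities. -/
lemma tendsto_intervalIntegral_of_weak {ι : Type*} {l : Filter ι} {u : ι → Vel d T}
    {u₀ : Vel d T} (hu : ∀ g, Tendsto (fun i => ⟪g, u i⟫) l (𝓝 ⟪g, u₀⟫))
    (s t : Icc (0 : ℝ) T) :
    Tendsto (fun i => ∫ r in (s : ℝ)..t, u i r) l (𝓝 (∫ r in (s : ℝ)..t, u₀ r)) := by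
  have h1 : ∀ A : Set ℝ, MeasurableSet A →
      Tendsto (fun i => ∫ r in A, u i r ∂(volume.restrict (Icc 0 T))) l
        (𝓝 (∫ r in A, u₀ r ∂(volume.restrict (Icc 0 T)))) := by
    intro A hA
    -- The test function is the indicator of `A` times `c`; basis vectors `c` then give the
    -- coordinates of the integral.
    have h2 : ∀ c : Vec d, Tendsto (fun i => ⟪c, ∫ r in A, u i r ∂(volume.restrict (Icc 0 T))⟫) l
        (𝓝 ⟪c, ∫ r in A, u₀ r ∂(volume.restrict (Icc 0 T))⟫) := by
      intro c
      have h3 := hu (indicatorConstLp 2 hA (measure_ne_top _ _) c)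
      simpa only [L2.inner_indicatorConstLp_eq_inner_setIntegral] using h3
    rw [(EuclideanSpace.equiv (Fin d) ℝ).toHomeomorph.isInducing.tendsto_nhds_iff,
      tendsto_pi_nhds]
    intro k
    have := h2 (EuclideanSpace.single k 1)
    simp only [EuclideanSpace.inner_single_left, map_one, one_mul] at this
    exact this
  simp_rw [intervalIntegral_eq_sub]
  exact (h1 _ measurableSet_Ioc).sub (h1 _ measurableSet_Ioc)

/-- Pointwise limits of curves with bounded velocities have a velocity, which is the weak limit
of the velocities. -/
lemma exists_velocity_of_tendsto (hp : IsProjection p) {ι : Type*} (l : Ultrafilter ι)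
    {w : ι → Icc (0 : ℝ) T → G} {w₀ : Icc (0 : ℝ) T → G}
    (hw : ∀ t, Tendsto (fun i => w i t) l (𝓝 (w₀ t))) {u : ι → Vel d T}
    (hu : ∀ᶠ i in l, IsVelocity p (w i) (u i)) {R : ℝ} (hR : ∀ᶠ i in l, ‖u i‖ ≤ R) :
    ∃ u₀ : Vel d T, IsVelocity p w₀ u₀ ∧ ∀ g, Tendsto (fun i => ⟪g, u i⟫) l (𝓝 ⟪g, u₀⟫) := by
  obtain ⟨u₀, hu₀⟩ := exists_weak_limit l hR
  refine ⟨u₀, ⟨Lp.memLp _, fun s t => ?_⟩, hu₀⟩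
  have h1 : Tendsto (fun i => w i t - w i s) l (𝓝 (w₀ t - w₀ s)) := (hw t).sub (hw s)
  have h2 : Tendsto (fun i => p (∫ r in (s : ℝ)..t, u i r)) l
      (𝓝 (p (∫ r in (s : ℝ)..t, u₀ r))) :=
    (hp.continuous.tendsto _).comp (tendsto_intervalIntegral_of_weak hu₀ s t)
  refine tendsto_nhds_unique h1 (h2.congr' ?_)
  filter_upwards [hu] with i hi
  exact (hi.2 s t).symm

/-- Curves of bounded energy are Hölder continuous. -/
lemma norm_intervalIntegral_le (u : Vel d T) (s t : Icc (0 : ℝ) T) :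
    ‖∫ r in (s : ℝ)..t, u r‖ ≤ Real.sqrt |(t : ℝ) - s| * ‖u‖ := by
  wlog hst : (s : ℝ) ≤ t generalizing s t
  · rw [intervalIntegral.integral_symm, norm_neg, abs_sub_comm]
    exact this t s (le_of_not_ge hst)
  have h1 : ∫ r in (s : ℝ)..t, u r = ∫ r in Ioc (s : ℝ) t, u r ∂(volume.restrict (Icc 0 T)) := by
    rw [intervalIntegral_eq_sub, Ioc_eq_empty (not_lt.2 hst)]
    simp
  rw [h1]
  -- Cauchy–Schwarz between `u` and the indicator of (s,t] times `I` bounds ‖I‖²; one factor ‖I‖ is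
  -- then divided out.
  set I := ∫ r in Ioc (s : ℝ) t, u r ∂(volume.restrict (Icc 0 T)) with hI
  have h2 := L2.inner_indicatorConstLp_eq_inner_setIntegral ℝ
    (measurableSet_Ioc (a := (s : ℝ)) (b := t)) (measure_ne_top (volume.restrict (Icc 0 T)) _) I u
  rw [← hI, real_inner_self_eq_norm_sq] at h2
  have h3 := real_inner_le_norm (indicatorConstLp 2 (measurableSet_Ioc (a := (s : ℝ)) (b := t))
    (measure_ne_top (volume.restrict (Icc 0 T)) _) I) u
  have h4 : ‖indicatorConstLp 2 (measurableSet_Ioc (a := (s : ℝ)) (b := t))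
      (measure_ne_top (volume.restrict (Icc 0 T)) _) I‖ ≤ ‖I‖ * Real.sqrt |(t : ℝ) - s| := by
    rw [norm_indicatorConstLp (by norm_num) (by norm_num)]
    gcongr
    rw [Real.sqrt_eq_rpow]
    simp only [ENNReal.toReal_ofNat]
    gcongr
    rw [abs_of_nonneg (by linarith), measureReal_restrict_apply measurableSet_Ioc]
    refine (measureReal_mono inter_subset_left (by simp)).trans ?_
    simp [Real.volume_real_Ioc_of_le hst]
  rw [h2] at h3
  rcases eq_or_ne I 0 with h0 | h0
  · rw [h0, norm_zero]; positivity
  · have h5 : ‖I‖ ^ 2 ≤ ‖I‖ * Real.sqrt |(t : ℝ) - s| * ‖u‖ :=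
      h3.trans (by gcongr)
    have h6 : 0 < ‖I‖ := norm_pos_iff.2 h0
    nlinarith

end Projection

/-! ### Kinetic and interaction energies. -/

section Energies

variable {d : ℕ} {T : ℝ} {G : Type} [NormedAddCommGroup G] {p : Vec d → G} {Ω : Set G}

/-- A curve in `Ω` regarded as a curve in the ambient group. -/
def ambient (γ : Curve T Ω) : C(Icc (0 : ℝ) T, G) := ⟨fun t => γ t, by fun_prop⟩

lemma continuous_ambient : Continuous (ambient : Curve T Ω → C(Icc (0 : ℝ) T, G)) :=
  ContinuousMap.continuous_postcomp (⟨Subtype.val, continuous_subtype_val⟩ : C(Ω, G))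

/-- The interaction weight `η(γ - ω)`. -/
def pairWeight (η : C(G, ℝ)) (γ ω : Curve T Ω) : C(Icc (0 : ℝ) T, ℝ) :=
  η.comp (ambient γ - ambient ω)

lemma continuous_pairWeight (η : C(G, ℝ)) :
    Continuous fun z : Curve T Ω × Curve T Ω => pairWeight η z.1 z.2 :=
  (ContinuousMap.continuous_postcomp η).comp
    ((continuous_ambient.comp continuous_fst).sub (continuous_ambient.comp continuous_snd))

lemma continuous_pairWeight_left (η : C(G, ℝ)) (σ : Curve T Ω) :
    Continuous fun γ : Curve T Ω => pairWeight η γ σ :=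
  (ContinuousMap.continuous_postcomp η).comp (continuous_ambient.sub continuous_const)

lemma isVelocity_velocity {w : Icc (0 : ℝ) T → G} (h : MemH1 p w) :
    IsVelocity p w (velocity p w) := by
  rw [velocity, dif_pos h]
  exact h.choose_spec

/-- Uniqueness of velocities frees the energy from the choice made in its definition. -/
lemma kineticEnergy_eq (hT : 0 < T) (hp : IsProjection p) {γ : Curve T Ω} {u : Vel d T}
    (h : IsVelocity p (ambient γ) u) :
    kineticEnergy p γ = ENNReal.ofReal (‖u‖ ^ 2 / 2) := by
  have hm : MemH1 p (fun t => (γ t : G)) := ⟨u, h⟩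
  have hae := (isVelocity_velocity hm).ae_eq hT hp h
  rw [kineticEnergy, if_pos hm, lintegral_congr_ae (g := fun t => ‖u t‖ₑ ^ 2)
    (hae.mono fun t ht => by simp only [ht]), lintegral_enorm_sq, div_eq_inv_mul,
    ENNReal.ofReal_mul (by norm_num), ENNReal.ofReal_inv_of_pos (by norm_num)]
  simp

lemma memH1_of_kineticEnergy_lt_top {γ : Curve T Ω} (h : kineticEnergy p γ < ⊤) :
    MemH1 p (ambient γ) := by
  by_contra hcon
  exact h.ne (if_neg hcon)

lemma exists_vel_of_kineticEnergy_lt_top {γ : Curve T Ω} (h : kineticEnergy p γ < ⊤) :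
    ∃ u : Vel d T, IsVelocity p (ambient γ) u :=
  (memH1_of_kineticEnergy_lt_top h).exists_vel

lemma interaction_eq (hT : 0 < T) (hp : IsProjection p) {η : C(G, ℝ)} (hη : ∀ z, 0 ≤ η z)
    {γ ω : Curve T Ω} {u : Vel d T} (h : IsVelocity p (ambient γ - ambient ω) u) :
    interaction p η γ ω =
      ENNReal.ofReal (weightedEnergy hT (pairWeight η γ ω) u / 2) := by
  have hm : MemH1 p (fun t => (γ t : G) - (ω t : G)) := ⟨u, h⟩
  have hae := (isVelocity_velocity hm).ae_eq hT hp h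
  have hae' := (ae_restrict_iff_subtype measurableSet_Icc).1 hae
  rw [interaction, if_pos hm, lintegral_congr_ae
    (g := fun t : Icc (0 : ℝ) T => ‖u t‖ₑ ^ 2 * ENNReal.ofReal (pairWeight η γ ω t))
    (hae'.mono fun t ht => by simp only [ht]; rfl),
    lintegral_weighted hT (fun t => hη _), div_eq_inv_mul,
    ENNReal.ofReal_mul (by norm_num), ENNReal.ofReal_inv_of_pos (by norm_num)]
  simp

lemma interaction_comm (hT : 0 < T) (hp : IsProjection p) {η : C(G, ℝ)} (hη : ∀ z, 0 ≤ η z)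
    (heven : ∀ z, η (-z) = η z) (γ ω : Curve T Ω) :
    interaction p η γ ω = interaction p η ω γ := by
  have key : ∀ γ ω : Curve T Ω, MemH1 p (fun t => (γ t : G) - (ω t : G)) →
      interaction p η γ ω = interaction p η ω γ := by
    intro γ ω h
    obtain ⟨u, hu⟩ := h.exists_vel
    have hu' : IsVelocity p (ambient ω - ambient γ) (-u : Vel d T) := by
      have h1 := hu.neg hp
      simp only [neg_sub] at h1
      exact h1
    rw [interaction_eq hT hp hη (γ := γ) (ω := ω) hu, interaction_eq hT hp hη hu',
      weightedEnergy_neg]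
    congr 3
    ext t
    change η ((γ t : G) - ω t) = η ((ω t : G) - γ t)
    rw [← heven, neg_sub]
  by_cases h : MemH1 p (fun t => (γ t : G) - (ω t : G))
  · exact key γ ω h
  · by_cases h' : MemH1 p (fun t => (ω t : G) - (γ t : G))
    · exact (key ω γ h').symm
    · rw [interaction, if_neg h, interaction, if_neg h']

/-- Parallelogram law for the two velocities. Positivity of `C` makes the right side infinite when a
kinetic energy is, since 0 · ∞ = 0. -/
lemma interaction_le (hT : 0 < T) (hp : IsProjection p) {η : C(G, ℝ)} (hη : ∀ z, 0 ≤ η z)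
    {C : ℝ} (hC : 0 < C) (hηC : ∀ z, η z ≤ C) (γ ω : Curve T Ω) :
    interaction p η γ ω ≤ ENNReal.ofReal (2 * C) * (kineticEnergy p γ + kineticEnergy p ω) := by
  have hC' : ENNReal.ofReal (2 * C) ≠ 0 := by simpa using hC
  by_cases h1 : kineticEnergy p γ < ⊤
  swap
  · rw [not_lt_top_iff.1 h1, top_add, ENNReal.mul_top hC']; exact le_top
  by_cases h2 : kineticEnergy p ω < ⊤
  swap
  · rw [not_lt_top_iff.1 h2, add_top, ENNReal.mul_top hC']; exact le_top
  obtain ⟨u, hu⟩ := exists_vel_of_kineticEnergy_lt_top h1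
  obtain ⟨u', hu'⟩ := exists_vel_of_kineticEnergy_lt_top h2
  rw [interaction_eq hT hp hη (hu.sub hp hu'), kineticEnergy_eq hT hp hu,
    kineticEnergy_eq hT hp hu', ← ENNReal.ofReal_add (by positivity) (by positivity),
    ← ENNReal.ofReal_mul (by positivity)]
  refine ENNReal.ofReal_le_ofReal ?_
  have h3 := weightedEnergy_le hT (φ := pairWeight η γ ω) (fun t => hηC _) (u - u')
  have h4 := parallelogram_law_with_norm ℝ u u'
  nlinarith [sq_nonneg ‖u + u'‖]

lemma weightedEnergy_one (hT : 0 < T) (u : Vel d T) : weightedEnergy hT 1 u = ‖u‖ ^ 2 := by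
  rw [weightedEnergy, inner_weightOp, ← real_inner_self_eq_norm_sq, L2.inner_def]
  simp

/-- Common core of both semicontinuity results: the kinetic energy is the case of weight 1, the
interaction that of weight η(γ − ω) on a difference of curves. -/
lemma exists_velocity_energy_le (hT : 0 < T) (hp : IsProjection p) {ι : Type*}
    (l : Ultrafilter ι) {w : ι → C(Icc (0 : ℝ) T, G)} {w₀ : C(Icc (0 : ℝ) T, G)}
    (hw : Tendsto w l (𝓝 w₀)) {φ : ι → C(Icc (0 : ℝ) T, ℝ)} {φ₀ : C(Icc (0 : ℝ) T, ℝ)}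
    (hφ : Tendsto φ l (𝓝 φ₀)) (hφ₀ : ∀ t, 0 ≤ φ₀ t) {u : ι → Vel d T}
    (hu : ∀ᶠ i in l, IsVelocity p (w i) (u i)) {R : ℝ} (hR : ∀ᶠ i in l, ‖u i‖ ≤ R)
    (hφn : ∀ i t, 0 ≤ φ i t) {ℓ : ℝ≥0∞}
    (hℓ : Tendsto (fun i => ENNReal.ofReal (weightedEnergy hT (φ i) (u i) / 2)) l (𝓝 ℓ)) :
    ∃ u₀ : Vel d T, IsVelocity p w₀ u₀ ∧
      ENNReal.ofReal (weightedEnergy hT φ₀ u₀ / 2) ≤ ℓ := by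
  obtain ⟨u₀, hu₀, hweak⟩ := exists_velocity_of_tendsto hp l
    (fun t => ((continuous_eval_const (F := C(Icc (0 : ℝ) T, G)) t).tendsto w₀).comp hw) hu hR
  refine ⟨u₀, hu₀, ?_⟩
  by_cases htop : ℓ = ⊤
  · simp [htop]
  have h1 : Tendsto (fun i => weightedEnergy hT (φ i) (u i)) l (𝓝 (2 * ℓ.toReal)) := by
    have h2 := ((ENNReal.tendsto_toReal htop).comp hℓ).const_mul 2
    refine h2.congr fun i => ?_
    have h3 := weightedEnergy_nonneg hT (hφn i) (u i)
    simp only [Function.comp_apply]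
    rw [ENNReal.toReal_ofReal (by positivity)]
    ring
  have h2 := weightedEnergy_le_of_weak hT hφ hφ₀ hR hweak h1
  rw [← ENNReal.ofReal_toReal htop]
  exact ENNReal.ofReal_le_ofReal (by linarith)

open Classical in
/-- The velocity of a curve of finite kinetic energy, as a square integrable function. -/
def curveVel (p : Vec d → G) (γ : Curve T Ω) : Vel d T :=
  if h : ∃ u : Vel d T, IsVelocity p (ambient γ) u then h.choose else 0

lemma isVelocity_curveVel {γ : Curve T Ω} (h : kineticEnergy p γ < ⊤) :
    IsVelocity p (ambient γ) (curveVel p γ) := by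
  rw [curveVel, dif_pos (exists_vel_of_kineticEnergy_lt_top h)]
  exact (exists_vel_of_kineticEnergy_lt_top h).choose_spec

lemma kineticEnergy_eq_curveVel (hT : 0 < T) (hp : IsProjection p) {γ : Curve T Ω}
    (h : kineticEnergy p γ < ⊤) :
    kineticEnergy p γ = ENNReal.ofReal (‖curveVel p γ‖ ^ 2 / 2) :=
  kineticEnergy_eq hT hp (isVelocity_curveVel h)

lemma exists_norm_curveVel_le (hT : 0 < T) (hp : IsProjection p) {ι : Type*} {l : Filter ι}
    {γ : ι → Curve T Ω} {k : ℝ≥0∞} (hk : k < ⊤)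
    (hγ : Tendsto (fun i => kineticEnergy p (γ i)) l (𝓝 k)) :
    ∃ R : ℝ, ∀ᶠ i in l, kineticEnergy p (γ i) < ⊤ ∧ ‖curveVel p (γ i)‖ ≤ R := by
  have h1 : k < k + 1 := ENNReal.lt_add_right hk.ne one_ne_zero
  refine ⟨Real.sqrt (2 * (k + 1).toReal), ?_⟩
  filter_upwards [hγ.eventually_lt_const h1] with i hi
  have h2 : k + 1 < ⊤ := ENNReal.add_lt_top.2 ⟨hk, by simp⟩
  have h3 := hi.trans h2
  refine ⟨h3, Real.le_sqrt_of_sq_le ?_⟩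
  rw [kineticEnergy_eq_curveVel hT hp h3] at hi
  have h4 := ENNReal.toReal_mono h2.ne hi.le
  rw [ENNReal.toReal_ofReal (by positivity)] at h4
  linarith

/-- Lower semicontinuity of the kinetic energy along ultrafilters. -/
lemma kineticEnergy_le_of_tendsto (hT : 0 < T) (hp : IsProjection p) {ι : Type*}
    (l : Ultrafilter ι) {γ : ι → Curve T Ω} {γ₀ : Curve T Ω} (hγ : Tendsto γ l (𝓝 γ₀))
    {k : ℝ≥0∞} (hk : Tendsto (fun i => kineticEnergy p (γ i)) l (𝓝 k)) :
    kineticEnergy p γ₀ ≤ k := by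
  rcases eq_or_ne k ⊤ with rfl | htop
  · exact le_top
  obtain ⟨R, hR⟩ := exists_norm_curveVel_le hT hp htop.lt_top hk
  obtain ⟨u₀, hu₀, hle⟩ := exists_velocity_energy_le hT hp l
    ((continuous_ambient.tendsto γ₀).comp hγ) (φ := fun _ => 1) tendsto_const_nhds
    (fun _ => zero_le_one) (hR.mono fun i hi => isVelocity_curveVel hi.1)
    (hR.mono fun i hi => hi.2) (fun _ _ => zero_le_one) (ℓ := k) (by
      refine hk.congr' ?_
      filter_upwards [hR] with i hi
      rw [weightedEnergy_one, kineticEnergy_eq_curveVel hT hp hi.1])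
  rw [kineticEnergy_eq hT hp hu₀, ← weightedEnergy_one hT]
  exact hle

/-- Lower semicontinuity of the interaction along curves of bounded energy. -/
lemma interaction_le_of_tendsto (hT : 0 < T) (hp : IsProjection p) {η : C(G, ℝ)}
    (hη : ∀ z, 0 ≤ η z) {ι : Type*} (l : Ultrafilter ι) {γ ω : ι → Curve T Ω}
    {γ₀ ω₀ : Curve T Ω} (hγ : Tendsto γ l (𝓝 γ₀)) (hω : Tendsto ω l (𝓝 ω₀))
    {k k' v : ℝ≥0∞} (hktop : k < ⊤) (hk : Tendsto (fun i => kineticEnergy p (γ i)) l (𝓝 k))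
    (hktop' : k' < ⊤) (hk' : Tendsto (fun i => kineticEnergy p (ω i)) l (𝓝 k'))
    (hv : Tendsto (fun i => interaction p η (γ i) (ω i)) l (𝓝 v)) :
    interaction p η γ₀ ω₀ ≤ v := by
  obtain ⟨R, hR⟩ := exists_norm_curveVel_le hT hp hktop hk
  obtain ⟨R', hR'⟩ := exists_norm_curveVel_le hT hp hktop' hk'
  have hsub : ∀ᶠ i in l, IsVelocity p (ambient (γ i) - ambient (ω i) : C(Icc (0 : ℝ) T, G))
      (curveVel p (γ i) - curveVel p (ω i) : Vel d T) := by
    filter_upwards [hR, hR'] with i hi hi'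
    exact (isVelocity_curveVel hi.1).sub hp (isVelocity_curveVel hi'.1)
  obtain ⟨u₀, hu₀, hle⟩ := exists_velocity_energy_le hT hp l
    (((continuous_ambient.tendsto γ₀).comp hγ).sub ((continuous_ambient.tendsto ω₀).comp hω))
    (((continuous_pairWeight η).tendsto (γ₀, ω₀)).comp (hγ.prodMk_nhds hω))
    (fun _ => hη _) hsub (R := R + R') (by
      filter_upwards [hR, hR'] with i hi hi'
      exact (norm_sub_le _ _).trans (add_le_add hi.2 hi'.2)) (fun _ _ => hη _) (ℓ := v) (by
      refine hv.congr' ?_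
      filter_upwards [hsub] with i hi
      exact interaction_eq hT hp hη hi)
  rw [interaction_eq hT hp hη hu₀]
  exact hle

lemma tendsto_kineticEnergy (hT : 0 < T) (hp : IsProjection p) {ι : Type*} {l : Filter ι}
    {γ : ι → Curve T Ω} {γ₀ : Curve T Ω} {u : ι → Vel d T} {u₀ : Vel d T}
    (hu : ∀ i, IsVelocity p (ambient (γ i)) (u i)) (hu₀ : IsVelocity p (ambient γ₀) u₀)
    (hlim : Tendsto u l (𝓝 u₀)) :
    Tendsto (fun i => kineticEnergy p (γ i)) l (𝓝 (kineticEnergy p γ₀)) := by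
  rw [kineticEnergy_eq hT hp hu₀]
  simp_rw [fun i => kineticEnergy_eq hT hp (hu i)]
  have h : Tendsto (fun i => ‖u i‖ ^ 2 / 2) l (𝓝 (‖u₀‖ ^ 2 / 2)) :=
    (hlim.norm.pow 2).div_const 2
  exact ENNReal.tendsto_ofReal h

lemma tendsto_sub_const_of_tendsto {H : Type*} [NormedAddCommGroup H] {ι : Type*} {l : Filter ι}
    {u : ι → H} {u₀ : H} (hu : Tendsto u l (𝓝 u₀)) (s : H) :
    Tendsto (fun i => u i - s) l (𝓝 (u₀ - s)) :=
  hu.sub_const s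

/-- With strong convergence of velocities the energy is continuous, not merely semicontinuous; this
is what keeps the modified competitors cheap. -/
lemma tendsto_interaction (hT : 0 < T) (hp : IsProjection p) {η : C(G, ℝ)}
    (hη : ∀ z, 0 ≤ η z) {ι : Type*} {l : Filter ι}
    {γ : ι → Curve T Ω} {γ₀ : Curve T Ω} {u : ι → Vel d T} {u₀ : Vel d T}
    (hγ : Tendsto γ l (𝓝 γ₀))
    (hu : ∀ i, IsVelocity p (ambient (γ i)) (u i)) (hu₀ : IsVelocity p (ambient γ₀) u₀)
    (hlim : Tendsto u l (𝓝 u₀)) {σ : Curve T Ω} (hσ : kineticEnergy p σ < ⊤) :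
    Tendsto (fun i => interaction p η (γ i) σ) l (𝓝 (interaction p η γ₀ σ)) := by
  have hs := isVelocity_curveVel hσ
  have h1 : Tendsto (fun i => pairWeight η (γ i) σ) l (𝓝 (pairWeight η γ₀ σ)) :=
    ((continuous_pairWeight_left η σ).tendsto γ₀).comp hγ
  have h2 : Tendsto (fun i => u i - curveVel p σ) l (𝓝 (u₀ - curveVel p σ)) :=
    tendsto_sub_const_of_tendsto hlim _
  have h3 := ENNReal.tendsto_ofReal ((tendsto_weightedEnergy hT h1 h2).div_const 2)
  have h4 : ∀ i, interaction p η (γ i) σ = ENNReal.ofReal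
      (weightedEnergy hT (pairWeight η (γ i) σ) (u i - curveVel p σ) / 2) := fun i =>
    interaction_eq hT hp hη (IsVelocity.sub hp (hu i) hs)
  have h5 : interaction p η γ₀ σ = ENNReal.ofReal
      (weightedEnergy hT (pairWeight η γ₀ σ) (u₀ - curveVel p σ) / 2) :=
    interaction_eq hT hp hη (IsVelocity.sub hp hu₀ hs)
  rw [h5]
  exact h3.congr fun i => (h4 i).symm

end Energies

lemma exists_tendsto_ultrafilter {ι : Type*} (l : Ultrafilter ι) (f : ι → ℝ≥0∞) :
    ∃ ℓ, Tendsto f l (𝓝 ℓ) :=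
  ⟨_, (l.map f).le_nhds_lim⟩

/-- Ultrafilters replace the extraction of subsequences: along one of them every quantity valued in
the compact space [0,∞] has a limit. -/
lemma lowerSemicontinuous_of_ultrafilter {X : Type*} [TopologicalSpace X] {f : X → ℝ≥0∞}
    (h : ∀ (l : Ultrafilter X) (x : X), Tendsto id (l : Filter X) (𝓝 x) →
      ∀ ℓ, Tendsto f l (𝓝 ℓ) → f x ≤ ℓ) : LowerSemicontinuous f := by
  intro x y hy
  by_contra hcon
  rw [Filter.not_eventually] at hcon
  have hne : (𝓝 x ⊓ 𝓟 {z | ¬ y < f z}).NeBot := Filter.frequently_mem_iff_neBot.1 hcon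
  obtain ⟨ℓ, hℓ⟩ := exists_tendsto_ultrafilter (Ultrafilter.of (𝓝 x ⊓ 𝓟 {z | ¬ y < f z})) f
  have hle := Ultrafilter.of_le (𝓝 x ⊓ 𝓟 {z | ¬ y < f z})
  have h1 := h _ x (tendsto_id.mono_left (hle.trans inf_le_left)) ℓ hℓ
  have h2 : ℓ ≤ y := by
    refine le_of_tendsto hℓ ?_
    filter_upwards [hle.trans inf_le_right (mem_principal_self _)] with z hz
    exact not_lt.1 hz
  exact absurd (h1.trans h2) (not_le.2 hy)

/-! ### The normalized individual cost. -/

section Cost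

variable {d : ℕ} {T : ℝ} {G : Type} [NormedAddCommGroup G] {p : Vec d → G} {Ω : Set G}

/-- The final time. -/
abbrev finalTime (hT : 0 < T) : Icc (0 : ℝ) T := ⟨T, right_mem_Icc.2 hT.le⟩

/-- The variation of the terminal cost along a curve. -/
def terminalGain (hT : 0 < T) (Ψ : Ω → ℝ) (γ : Curve T Ω) : ℝ :=
  Ψ (γ (finalTime hT)) - Ψ (evalZero hT γ)

lemma continuous_evalZero (hT : 0 < T) : Continuous (evalZero hT : Curve T Ω → Ω) :=
  continuous_eval_const _

lemma continuous_terminalGain (hT : 0 < T) {Ψ : Ω → ℝ} (hΨ : Continuous Ψ) :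
    Continuous (terminalGain hT Ψ) :=
  (hΨ.comp (continuous_eval_const _)).sub (hΨ.comp (continuous_evalZero hT))

/-- The standing assumptions: the variation of the terminal cost is controlled by the energy. -/
structure Admissible (p : Vec d → G) (hT : 0 < T) (Ψ : Ω → ℝ) (δ C₀ : ℝ) : Prop where
  proj : IsProjection p
  cont : Continuous Ψ
  pos : 0 < δ
  nonneg : 0 ≤ C₀
  bound : ∀ γ : Curve T Ω, kineticEnergy p γ < ⊤ →
    |terminalGain hT Ψ γ| ≤ δ / 2 * (kineticEnergy p γ).toReal + C₀

open Classical in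
/-- The individual cost of a curve, normalized to be nonnegative. -/
def indivCost (p : Vec d → G) (hT : 0 < T) (Ψ : Ω → ℝ) (δ C₀ : ℝ) (γ : Curve T Ω) : ℝ≥0∞ :=
  if kineticEnergy p γ < ⊤ then
    ENNReal.ofReal (δ * (kineticEnergy p γ).toReal + terminalGain hT Ψ γ + C₀)
  else ⊤

variable {hT : 0 < T} {Ψ : Ω → ℝ} {δ C₀ : ℝ}

/-- Coercivity: half of the kinetic term and `C₀` absorb the terminal gain. -/
lemma kineticEnergy_le_indivCost (hA : Admissible p hT Ψ δ C₀) (γ : Curve T Ω) :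
    ENNReal.ofReal (δ / 2) * kineticEnergy p γ ≤ indivCost p hT Ψ δ C₀ γ := by
  rw [indivCost]
  split_ifs with h
  · have h1 := abs_le.1 (hA.bound γ h)
    have hδ := hA.pos
    rw [← ENNReal.ofReal_toReal h.ne, ← ENNReal.ofReal_mul (by positivity),
      ENNReal.toReal_ofReal ENNReal.toReal_nonneg]
    exact ENNReal.ofReal_le_ofReal (by linarith [h1.1])
  · exact le_top

lemma kineticEnergy_lt_top_of_indivCost {γ : Curve T Ω}
    (h : indivCost p hT Ψ δ C₀ γ < ⊤) : kineticEnergy p γ < ⊤ := by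
  by_contra hcon
  rw [indivCost, if_neg hcon] at h
  exact h.ne rfl

lemma lintegral_kineticEnergy_lt_top [MeasurableSpace G] (hA : Admissible p hT Ψ δ C₀)
    {Q : Measure (Curve T Ω)} (hQ : ∫⁻ γ, indivCost p hT Ψ δ C₀ γ ∂Q < ⊤) :
    ∫⁻ γ, kineticEnergy p γ ∂Q < ⊤ := by
  have h1 := (lintegral_mono (μ := Q) (kineticEnergy_le_indivCost hA)).trans_lt hQ
  rw [lintegral_const_mul' _ _ ENNReal.ofReal_ne_top] at h1
  refine ENNReal.lt_top_of_mul_ne_top_right h1.ne ?_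
  have := hA.pos
  simpa using this

lemma kineticLimit_lt_top (hA : Admissible p hT Ψ δ C₀) {ι : Type*} (l : Ultrafilter ι)
    {γ : ι → Curve T Ω} {k ℓ : ℝ≥0∞}
    (hk : Tendsto (fun i => kineticEnergy p (γ i)) l (𝓝 k))
    (hℓ : Tendsto (fun i => indivCost p hT Ψ δ C₀ (γ i)) l (𝓝 ℓ)) (htop : ℓ < ⊤) : k < ⊤ := by
  have h1 := le_of_tendsto_of_tendsto
    (ENNReal.Tendsto.const_mul hk (Or.inr (ENNReal.ofReal_ne_top (r := δ / 2)))) hℓ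
    (Eventually.of_forall fun i => kineticEnergy_le_indivCost hA (γ i))
  refine ENNReal.lt_top_of_mul_ne_top_right (h1.trans_lt htop).ne ?_
  have := hA.pos
  simpa using this

lemma indivCost_le_of_tendsto (hA : Admissible p hT Ψ δ C₀) {ι : Type*} (l : Ultrafilter ι)
    {γ : ι → Curve T Ω} {γ₀ : Curve T Ω} (hγ : Tendsto γ l (𝓝 γ₀)) {ℓ : ℝ≥0∞}
    (hℓ : Tendsto (fun i => indivCost p hT Ψ δ C₀ (γ i)) l (𝓝 ℓ)) :
    indivCost p hT Ψ δ C₀ γ₀ ≤ ℓ := by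
  rcases eq_or_ne ℓ ⊤ with rfl | htop
  · exact le_top
  obtain ⟨k, hk⟩ := exists_tendsto_ultrafilter l fun i => kineticEnergy p (γ i)
  have hktop := kineticLimit_lt_top hA l hk hℓ htop.lt_top
  have hle := kineticEnergy_le_of_tendsto hT hA.proj l hγ hk
  have hr := ((continuous_terminalGain hT hA.cont).tendsto γ₀).comp hγ
  have h1 : Tendsto (fun i => ENNReal.ofReal (δ * (kineticEnergy p (γ i)).toReal +
      terminalGain hT Ψ (γ i) + C₀)) l
      (𝓝 (ENNReal.ofReal (δ * k.toReal + terminalGain hT Ψ γ₀ + C₀))) :=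
    ENNReal.tendsto_ofReal (((((ENNReal.tendsto_toReal hktop.ne).comp hk).const_mul δ).add
      hr).add_const C₀)
  have h2 : ℓ = ENNReal.ofReal (δ * k.toReal + terminalGain hT Ψ γ₀ + C₀) := by
    refine tendsto_nhds_unique hℓ (h1.congr' ?_)
    filter_upwards [hk.eventually_lt_const hktop] with i hi
    rw [indivCost, if_pos hi]
  rw [h2, indivCost, if_pos (hle.trans_lt hktop)]
  refine ENNReal.ofReal_le_ofReal ?_
  have := hA.pos
  gcongr
  exact hktop.ne

lemma lowerSemicontinuous_indivCost (hA : Admissible p hT Ψ δ C₀) :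
    LowerSemicontinuous (indivCost p hT Ψ δ C₀) :=
  lowerSemicontinuous_of_ultrafilter fun l _ hx _ hℓ => indivCost_le_of_tendsto hA l hx hℓ

/-- The interaction cost, including its coefficient. -/
def pairCost (p : Vec d → G) (η : C(G, ℝ)) (lam : ℝ) (γ ω : Curve T Ω) : ℝ≥0∞ :=
  ENNReal.ofReal lam * interaction p η γ ω

lemma lowerSemicontinuous_totalPair (hA : Admissible p hT Ψ δ C₀) {η : C(G, ℝ)}
    (hη : ∀ z, 0 ≤ η z) (lam : ℝ) :
    LowerSemicontinuous fun z : Curve T Ω × Curve T Ω =>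
      indivCost p hT Ψ δ C₀ z.1 + indivCost p hT Ψ δ C₀ z.2 + pairCost p η lam z.1 z.2 := by
  refine lowerSemicontinuous_of_ultrafilter fun l z hz ℓ hℓ => ?_
  have hz1 : Tendsto (fun z : Curve T Ω × Curve T Ω => z.1) l (𝓝 z.1) :=
    (continuous_fst.tendsto z).comp hz
  have hz2 : Tendsto (fun z : Curve T Ω × Curve T Ω => z.2) l (𝓝 z.2) :=
    (continuous_snd.tendsto z).comp hz
  obtain ⟨a, ha⟩ := exists_tendsto_ultrafilter l fun z => indivCost p hT Ψ δ C₀ z.1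
  obtain ⟨b, hb⟩ := exists_tendsto_ultrafilter l fun z => indivCost p hT Ψ δ C₀ z.2
  obtain ⟨v, hv⟩ := exists_tendsto_ultrafilter l fun z => interaction p η z.1 z.2
  obtain ⟨k, hk⟩ := exists_tendsto_ultrafilter l fun z => kineticEnergy p z.1
  obtain ⟨k', hk'⟩ := exists_tendsto_ultrafilter l fun z => kineticEnergy p z.2
  have hsum : ℓ = a + b + ENNReal.ofReal lam * v :=
    tendsto_nhds_unique hℓ ((ha.add hb).add
      (ENNReal.Tendsto.const_mul hv (Or.inr ENNReal.ofReal_ne_top)))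
  rcases eq_or_ne ℓ ⊤ with rfl | htop
  · exact le_top
  -- The individual costs supply the kinetic bounds under which the interaction was shown
  -- semicontinuous; if those costs blow up, there is nothing to prove.
  have hab : a + b < ⊤ := lt_of_le_of_lt (by rw [hsum]; exact le_self_add) htop.lt_top
  rw [hsum, pairCost]
  refine add_le_add (add_le_add (indivCost_le_of_tendsto hA l hz1 ha)
    (indivCost_le_of_tendsto hA l hz2 hb)) (mul_le_mul_right ?_ _)
  exact interaction_le_of_tendsto hT hA.proj hη l hz1 hz2
    (kineticLimit_lt_top hA l hk ha (lt_of_le_of_lt le_self_add hab)) hk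
    (kineticLimit_lt_top hA l hk' hb (lt_of_le_of_lt le_add_self hab)) hk' hv

lemma pairCost_le (hA : Admissible p hT Ψ δ C₀) {η : C(G, ℝ)}
    (hη : ∀ z, 0 ≤ η z) (lam : ℝ) {C : ℝ} (hC : 0 < C) (hηC : ∀ z, η z ≤ C) :
    ∃ B : ℝ≥0∞, B ≠ ⊤ ∧ ∀ γ ω : Curve T Ω, pairCost p η lam γ ω ≤
      B * (indivCost p hT Ψ δ C₀ γ + indivCost p hT Ψ δ C₀ ω) := by
  have hδ : ENNReal.ofReal (δ / 2) ≠ 0 := by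
    have := hA.pos
    simpa using this
  have hδ' : ENNReal.ofReal (δ / 2) ≠ ⊤ := ENNReal.ofReal_ne_top
  refine ⟨ENNReal.ofReal lam * (ENNReal.ofReal (2 * C) * (ENNReal.ofReal (δ / 2))⁻¹),
    ENNReal.mul_ne_top ENNReal.ofReal_ne_top
      (ENNReal.mul_ne_top ENNReal.ofReal_ne_top (ENNReal.inv_ne_top.2 hδ)), fun γ ω => ?_⟩
  have h1 : ∀ γ : Curve T Ω, kineticEnergy p γ ≤
      (ENNReal.ofReal (δ / 2))⁻¹ * indivCost p hT Ψ δ C₀ γ := fun γ => by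
    rw [← ENNReal.mul_le_mul_iff_right hδ hδ', ← mul_assoc, ENNReal.mul_inv_cancel hδ hδ',
      one_mul]
    exact kineticEnergy_le_indivCost hA γ
  calc pairCost p η lam γ ω ≤ ENNReal.ofReal lam * (ENNReal.ofReal (2 * C) *
        (kineticEnergy p γ + kineticEnergy p ω)) := by
        rw [pairCost]; gcongr; exact interaction_le hT hA.proj hη hC hηC γ ω
    _ ≤ ENNReal.ofReal lam * (ENNReal.ofReal (2 * C) *
        ((ENNReal.ofReal (δ / 2))⁻¹ * indivCost p hT Ψ δ C₀ γ +
          (ENNReal.ofReal (δ / 2))⁻¹ * indivCost p hT Ψ δ C₀ ω)) := by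
        gcongr <;> exact h1 _
    _ = _ := by ring

/-- The correction depends on γ(0) alone, so it is common to all competitors of a given curve. -/
lemma totalCost_eq [MeasurableSpace G] (hA : Admissible p hT Ψ δ C₀) (η : C(G, ℝ)) (lam : ℝ)
    (Q : Measure (Curve T Ω)) (γ : Curve T Ω) :
    totalCost p hT Ψ δ η lam γ Q =
      ((playerCost (indivCost p hT Ψ δ C₀) (pairCost p η lam) Q γ : ℝ≥0∞) : EReal) +
        ((Ψ (evalZero hT γ) - C₀ : ℝ) : EReal) := by
  have h1 : ∫⁻ ω, pairCost p η lam γ ω ∂Q =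
      ENNReal.ofReal lam * ∫⁻ ω, interaction p η γ ω ∂Q :=
    lintegral_const_mul' _ _ ENNReal.ofReal_ne_top
  have hδ := hA.pos
  rw [playerCost, h1, totalCost]
  set J := ENNReal.ofReal lam * ∫⁻ ω, interaction p η γ ω ∂Q
  rw [indivCost]
  split_ifs with h
  · have h2 := abs_le.1 (hA.bound γ h)
    have hK : 0 ≤ (kineticEnergy p γ).toReal := ENNReal.toReal_nonneg
    have h3 : ENNReal.ofReal δ * kineticEnergy p γ =
        ENNReal.ofReal (δ * (kineticEnergy p γ).toReal) := by
      rw [ENNReal.ofReal_mul hδ.le, ENNReal.ofReal_toReal h.ne]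
    rw [h3, EReal.coe_ennreal_add, EReal.coe_ennreal_ofReal, EReal.coe_ennreal_ofReal,
      max_eq_left (by positivity), max_eq_left (by nlinarith [h2.1]), ← EReal.coe_add,
      add_right_comm _ (J : EReal), ← EReal.coe_add]
    congr 2
    simp only [terminalGain]
    ring
  · rw [not_lt_top_iff.1 h, ENNReal.mul_top (by simpa using hδ), top_add]
    simp only [EReal.coe_ennreal_top]
    rw [EReal.top_add_coe, EReal.top_add_coe]
    exact EReal.top_add_of_ne_bot (EReal.coe_ennreal_ne_bot _)

end Cost

/-! ### Compactness of curves of bounded cost. -/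

section Compactness

variable {d : ℕ} {T : ℝ} {G : Type} [NormedAddCommGroup G] {p : Vec d → G} {Ω : Set G}
  {hT : 0 < T} {Ψ : Ω → ℝ} {δ C₀ : ℝ}

lemma norm_sub_le_of_isVelocity (hp : IsProjection p) {γ : Curve T Ω} {u : Vel d T}
    (h : IsVelocity p (ambient γ) u) (s t : Icc (0 : ℝ) T) :
    ‖(γ t : G) - γ s‖ ≤ Real.sqrt |(t : ℝ) - s| * ‖u‖ := by
  have h1 : (γ t : G) - γ s = p (∫ r in (s : ℝ)..t, u r) := h.2 s t
  rw [h1]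
  exact (hp.norm_le _).trans (norm_intervalIntegral_le u s t)

lemma isCompact_closure_of_equicontinuous {X Y : Type*} [MetricSpace X] [CompactSpace X]
    [MetricSpace Y] {s : Set Y} (hs : IsCompact s) (A : Set C(X, Y))
    (hA : ∀ f ∈ A, ∀ x, f x ∈ s) (hequi : Equicontinuous fun (f : A) x => (f : C(X, Y)) x) :
    IsCompact (closure A) := by
  let e := ContinuousMap.isometryEquivBoundedOfCompact X Y
  have h1 : IsCompact (closure (e '' A)) := by
    refine BoundedContinuousFunction.arzela_ascoli s hs _ ?_ ?_
    · rintro _ x ⟨f, hf, rfl⟩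
      exact hA f hf x
    · intro x U hU
      filter_upwards [hequi x U hU] with y hy
      rintro ⟨_, f, hf, rfl⟩
      exact hy ⟨f, hf⟩
  have h2 : closure (e '' A) = e '' closure A :=
    (e.toHomeomorph.image_closure A).symm
  rw [h2] at h1
  exact e.toHomeomorph.isCompact_image.1 h1

/-- Curves of bounded cost starting in a compact set are relatively compact. -/
lemma exists_isCompact_of_indivCost_le [ProperSpace G] (hA : Admissible p hT Ψ δ C₀)
    (hΩ : IsClosed Ω) {C : Set Ω} (hC : IsCompact C) {M : ℝ≥0∞} (hM : M ≠ ⊤) :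
    ∃ K : Set (Curve T Ω), IsCompact K ∧
      {γ | evalZero hT γ ∈ C ∧ indivCost p hT Ψ δ C₀ γ ≤ M} ⊆ K := by
  set A := {γ : Curve T Ω | evalZero hT γ ∈ C ∧ indivCost p hT Ψ δ C₀ γ ≤ M} with hAdef
  have hδ := hA.pos
  obtain ⟨R, hR0, hR⟩ : ∃ R : ℝ, 0 ≤ R ∧ ∀ γ ∈ A, ∀ s t : Icc (0 : ℝ) T,
      ‖(γ t : G) - γ s‖ ≤ Real.sqrt |(t : ℝ) - s| * R := by
    -- Coercivity gives (δ/2)(‖u‖²/2) ≤ M, hence this bound on ‖u‖.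
    refine ⟨Real.sqrt (4 / δ * M.toReal), Real.sqrt_nonneg _, fun γ hγ s t => ?_⟩
    have hK := kineticEnergy_lt_top_of_indivCost (hγ.2.trans_lt hM.lt_top)
    obtain ⟨u, hu⟩ := exists_vel_of_kineticEnergy_lt_top hK
    refine (norm_sub_le_of_isVelocity hA.proj hu s t).trans ?_
    gcongr
    refine Real.le_sqrt_of_sq_le ?_
    have h1 := ENNReal.toReal_mono hM ((kineticEnergy_le_indivCost hA γ).trans hγ.2)
    rw [kineticEnergy_eq hT hA.proj hu, ENNReal.toReal_mul, ENNReal.toReal_ofReal (by positivity),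
      ENNReal.toReal_ofReal (by positivity)] at h1
    rw [div_mul_eq_mul_div, le_div_iff₀ hδ]
    linarith
  obtain ⟨R₀, hR₀⟩ := ((hC.image continuous_subtype_val).isBounded).subset_closedBall (0 : G)
  refine ⟨closure A, isCompact_closure_of_equicontinuous
    (s := Subtype.val ⁻¹' Metric.closedBall (0 : G) (Real.sqrt T * R + R₀)) ?_ A ?_ ?_,
    subset_closure⟩
  · exact hΩ.isClosedEmbedding_subtypeVal.isCompact_preimage (isCompact_closedBall _ _)
  · intro γ hγ t
    have h1 : ‖(evalZero hT γ : G)‖ ≤ R₀ := by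
      simpa using hR₀ (mem_image_of_mem _ hγ.1)
    have h2 := hR γ hγ ⟨0, left_mem_Icc.2 hT.le⟩ t
    have h3 : Real.sqrt |(t : ℝ) - 0| ≤ Real.sqrt T := by
      refine Real.sqrt_le_sqrt ?_
      rw [sub_zero, abs_of_nonneg t.2.1]
      exact t.2.2
    simp only [mem_preimage, Metric.mem_closedBall, dist_zero_right]
    calc ‖(γ t : G)‖ = ‖((γ t : G) - evalZero hT γ) + evalZero hT γ‖ := by rw [sub_add_cancel]
      _ ≤ _ := norm_add_le _ _
      _ ≤ _ := add_le_add (h2.trans (by gcongr)) h1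
  · refine Metric.equicontinuous_of_continuity_modulus (fun x => Real.sqrt |x| * R) ?_ _ ?_
    · have : Continuous fun x : ℝ => Real.sqrt |x| * R := by fun_prop
      simpa using this.tendsto 0
    · rintro s t ⟨γ, hγ⟩
      have h1 := hR γ hγ t s
      rw [← dist_eq_norm] at h1
      rw [abs_of_nonneg dist_nonneg]
      exact h1

/-- Immobile players have finite cost. -/
lemma exists_constant_law [MeasurableSpace G] [BorelSpace G] (hA : Admissible p hT Ψ δ C₀)
    (m₀ : Measure Ω) [IsProbabilityMeasure m₀] :
    ∃ Q : Measure (Curve T Ω), IsProbabilityMeasure Q ∧ Q.map (evalZero hT) = m₀ ∧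
      ∫⁻ γ, indivCost p hT Ψ δ C₀ γ ∂Q < ⊤ := by
  have hc : Continuous (ContinuousMap.const (Icc (0 : ℝ) T) : Ω → Curve T Ω) :=
    ContinuousMap.continuous_const'
  refine ⟨m₀.map (ContinuousMap.const _),
    Measure.isProbabilityMeasure_map hc.measurable.aemeasurable, ?_, ?_⟩
  · rw [Measure.map_map (continuous_evalZero hT).measurable hc.measurable]
    exact Measure.map_id
  · rw [lintegral_map (lowerSemicontinuous_indivCost hA).measurable hc.measurable]
    have h1 : ∀ x : Ω, indivCost p hT Ψ δ C₀ (ContinuousMap.const _ x) = ENNReal.ofReal C₀ := by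
      intro x
      have hv : IsVelocity p (ambient (ContinuousMap.const (Icc (0 : ℝ) T) x)) (0 : Vel d T) := by
        refine ⟨Lp.memLp _, fun s t => ?_⟩
        rw [intervalIntegral_congr_restrict (Lp.coeFn_zero (Vec d) 2 _)]
        simp [ambient, hA.proj.map_zero]
      have hK := kineticEnergy_eq hT hA.proj hv
      rw [norm_zero] at hK
      rw [indivCost, hK, if_pos ENNReal.ofReal_lt_top]
      simp [terminalGain, evalZero]
    simp_rw [h1]
    simp

end Compactness

/-! ### Continuity of the player cost under strong convergence of velocities. -/

section Stability

variable {d : ℕ} {T : ℝ} {G : Type} [NormedAddCommGroup G] [MeasurableSpace G]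
  {p : Vec d → G} {Ω : Set G} [SecondCountableTopology (Curve T Ω)]
  {hT : 0 < T} {Ψ : Ω → ℝ} {δ C₀ : ℝ}

/-- The cost of a player is continuous for the uniform convergence of curves with strong
convergence of velocities. -/
lemma tendsto_playerCost (hA : Admissible p hT Ψ δ C₀) {η : C(G, ℝ)}
    (hη : ∀ z, 0 ≤ η z) (lam : ℝ) {C : ℝ} (hC : 0 < C) (hηC : ∀ z, η z ≤ C)
    {Q : Measure (Curve T Ω)} [IsProbabilityMeasure Q]
    (hQ : ∫⁻ γ, indivCost p hT Ψ δ C₀ γ ∂Q < ⊤) {ι : Type*} {l : Filter ι}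
    [l.IsCountablyGenerated] {γ : ι → Curve T Ω} {γ₀ : Curve T Ω} (hγ : Tendsto γ l (𝓝 γ₀))
    {u : ι → Vel d T} {u₀ : Vel d T} (hu : ∀ i, IsVelocity p (ambient (γ i)) (u i))
    (hu₀ : IsVelocity p (ambient γ₀) u₀) (hlim : Tendsto u l (𝓝 u₀)) :
    Tendsto (fun i => playerCost (indivCost p hT Ψ δ C₀) (pairCost p η lam) Q (γ i)) l
      (𝓝 (playerCost (indivCost p hT Ψ δ C₀) (pairCost p η lam) Q γ₀)) := by
  have hfin : ∀ (σ : Curve T Ω) (v : Vel d T), IsVelocity p (ambient σ) v →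
      kineticEnergy p σ < ⊤ := fun σ v h => by
    rw [kineticEnergy_eq hT hA.proj h]; exact ENNReal.ofReal_lt_top
  have hcfin : ∀ (σ : Curve T Ω), kineticEnergy p σ < ⊤ → indivCost p hT Ψ δ C₀ σ < ⊤ :=
    fun σ h => by rw [indivCost, if_pos h]; exact ENNReal.ofReal_lt_top
  have hcm := (lowerSemicontinuous_indivCost hA).measurable
  have hk := tendsto_kineticEnergy hT hA.proj hu hu₀ hlim
  have hKQ := lintegral_kineticEnergy_lt_top hA hQ
  have hae : ∀ᵐ σ ∂Q, kineticEnergy p σ < ⊤ := by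
    filter_upwards [ae_lt_top hcm hQ.ne] with σ hσ using kineticEnergy_lt_top_of_indivCost hσ
  refine Tendsto.add ?_ ?_
  · rw [indivCost, if_pos (hfin _ _ hu₀)]
    have h1 : ∀ i, indivCost p hT Ψ δ C₀ (γ i) = ENNReal.ofReal
        (δ * (kineticEnergy p (γ i)).toReal + terminalGain hT Ψ (γ i) + C₀) := fun i => by
      rw [indivCost, if_pos (hfin _ _ (hu i))]
    simp_rw [h1]
    exact ENNReal.tendsto_ofReal (((((ENNReal.tendsto_toReal (hfin _ _ hu₀).ne).comp
      hk).const_mul δ).add (((continuous_terminalGain hT hA.cont).tendsto γ₀).comp hγ)).add_const C₀)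
  -- The dominating function comes from `interaction_le`: the kinetic energies along the family
  -- eventually stay below their limit plus 1, and the kinetic energy is `Q`-integrable.
  · refine tendsto_lintegral_filter_of_dominated_convergence'
      (fun σ => ENNReal.ofReal lam * (ENNReal.ofReal (2 * C) *
        ((kineticEnergy p γ₀ + 1) + kineticEnergy p σ))) ?_ ?_ ?_ ?_
    · refine Eventually.of_forall fun i => ?_
      -- The truncated interaction serves as a measurable representative.
      have hm := measurable_truncPair hcm (lowerSemicontinuous_totalPair hA hη lam)
      refine ⟨fun σ => truncPair (indivCost p hT Ψ δ C₀) (pairCost p η lam) (γ i) σ,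
        hm.comp measurable_prodMk_left, ?_⟩
      filter_upwards [ae_lt_top hcm hQ.ne] with σ hσ
      rw [truncPair, if_pos ⟨hcfin _ (hfin _ _ (hu i)), hσ⟩]
    · have h1 : kineticEnergy p γ₀ < kineticEnergy p γ₀ + 1 :=
        ENNReal.lt_add_right (hfin _ _ hu₀).ne one_ne_zero
      filter_upwards [hk.eventually_lt_const h1] with i hi
      refine Eventually.of_forall fun σ => ?_
      rw [pairCost]
      gcongr
      refine (interaction_le hT hA.proj hη hC hηC (γ i) σ).trans ?_
      gcongr
    · rw [lintegral_const_mul' _ _ ENNReal.ofReal_ne_top,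
        lintegral_const_mul' _ _ ENNReal.ofReal_ne_top, lintegral_add_left measurable_const]
      refine ENNReal.mul_ne_top ENNReal.ofReal_ne_top (ENNReal.mul_ne_top ENNReal.ofReal_ne_top
        (ENNReal.add_ne_top.2 ⟨?_, hKQ.ne⟩))
      simpa using (hfin _ _ hu₀).ne
    · filter_upwards [hae] with σ hσ
      exact ENNReal.Tendsto.const_mul (tendsto_interaction hT hA.proj hη hγ hu hu₀ hlim hσ)
        (Or.inr ENNReal.ofReal_ne_top)

end Stability

/-! ### From lifting of initial laws to equilibria. -/

section Equilibrium

variable {d : ℕ} {T : ℝ} {G : Type} [NormedAddCommGroup G] [ProperSpace G] [MeasurableSpace G]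
  [BorelSpace G] {p : Vec d → G} {Ω : Set G} {hT : 0 < T} {Ψ : Ω → ℝ} {δ C₀ : ℝ}

/-- Initial laws concentrated near the starting point of `ω` lift to laws on curves that are
almost as cheap as `ω`. -/
def LiftsInitialLaws (hT : 0 < T) (f : Curve T Ω → ℝ≥0∞) : Prop :=
  ∀ (ω : Curve T Ω) (m : ℝ≥0∞), f ω < m → ∃ r > 0, ∀ ν : Measure Ω, IsProbabilityMeasure ν →
    (∀ᵐ y ∂ν, dist y (evalZero hT ω) < r) → ∃ μ : Measure (Curve T Ω), IsProbabilityMeasure μ ∧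
      μ.map (evalZero hT) = ν ∧ ∀ᵐ γ ∂μ, f γ ≤ m

theorem exists_equilibrium_of_lifts (hA : Admissible p hT Ψ δ C₀) (hΩ : IsClosed Ω)
    {η : C(G, ℝ)} (hη : ∀ z, 0 ≤ η z) (heven : ∀ z, η (-z) = η z) {C : ℝ} (hC : 0 < C)
    (hηC : ∀ z, η z ≤ C) (lam : ℝ) (m₀ : Measure Ω) [IsProbabilityMeasure m₀]
    (hm₀ : ∫⁻ x, ENNReal.ofReal (Ψ x) ∂m₀ < ⊤)
    (hlift : ∀ Q : Measure (Curve T Ω), IsProbabilityMeasure Q →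
      ∫⁻ γ, indivCost p hT Ψ δ C₀ γ ∂Q < ⊤ →
      LiftsInitialLaws hT (playerCost (indivCost p hT Ψ δ C₀) (pairCost p η lam) Q)) :
    ∃ Q ∈ initialLaw hT m₀, IsEquilibrium p hT Ψ δ η lam m₀ Q := by
  have : CompleteSpace Ω := hΩ.completeSpace_coe
  obtain ⟨B, hB, hVB⟩ := pairCost_le hA hη lam hC hηC
  obtain ⟨Q, hQp, hQe, -, hQF, hopt⟩ := exists_potential_equilibrium
    (e := (evalZero hT : Curve T Ω → Ω)) (V := pairCost p η lam)
    (continuous_evalZero hT) (lowerSemicontinuous_indivCost hA)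
    (lowerSemicontinuous_totalPair hA hη lam)
    (fun γ ω => by rw [pairCost, pairCost, interaction_comm hT hA.proj hη heven]) hB hVB
    (fun K hK M hM => exists_isCompact_of_indivCost_le hA hΩ hK hM) m₀
    (exists_constant_law hA m₀) hlift
  refine ⟨Q, ⟨hQp, hQe⟩, ⟨⟨hQp, hQe⟩, ?_, ?_⟩⟩
  · have hΨm : Measurable fun x => ENNReal.ofReal (Ψ x) := hA.cont.measurable.ennreal_ofReal
    have h1 : ∫⁻ γ, ENNReal.ofReal (Ψ (evalZero hT γ)) ∂Q < ⊤ := by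
      rwa [← lintegral_map hΨm (continuous_evalZero hT).measurable, hQe]
    -- Undoing the normalization costs at most the positive part of Ψ at the starting point, because
    -- C₀ ≥ 0.
    have h2 : ∀ γ, (totalCost p hT Ψ δ η lam γ Q).toENNReal ≤
        playerCost (indivCost p hT Ψ δ C₀) (pairCost p η lam) Q γ +
          ENNReal.ofReal (Ψ (evalZero hT γ)) := by
      intro γ
      rw [totalCost_eq hA]
      refine EReal.toENNReal_add_le.trans ?_
      rw [EReal.toENNReal_coe, EReal.toENNReal_of_ne_top (EReal.coe_ne_top _), EReal.toReal_coe]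
      gcongr
      linarith [hA.nonneg]
    refine (lintegral_mono h2).trans_lt ?_
    have hm : Measurable fun γ : Curve T Ω => ENNReal.ofReal (Ψ (evalZero hT γ)) :=
      hΨm.comp (continuous_evalZero hT).measurable
    rw [lintegral_add_right _ hm]
    exact ENNReal.add_lt_top.2 ⟨hQF, h1⟩
  · intro γ hγ
    refine le_antisymm (le_iInf₂ fun ω hω => ?_) (iInf_le_of_le γ (iInf_le_of_le rfl le_rfl))
    rw [totalCost_eq hA, totalCost_eq hA, hω]
    gcongr
    exact EReal.coe_ennreal_le_coe_ennreal_iff.2 (hopt γ hγ ω hω)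

/-- On the whole group, laws are lifted by translating a curve. -/
lemma liftsInitialLaws_of_eq_univ (hA : Admissible p hT Ψ δ C₀) (hΩ : Ω = univ)
    {η : C(G, ℝ)} (hη : ∀ z, 0 ≤ η z) {C : ℝ} (hC : 0 < C)
    (hηC : ∀ z, η z ≤ C) (lam : ℝ) (Q : Measure (Curve T Ω)) [IsProbabilityMeasure Q]
    (hQ : ∫⁻ γ, indivCost p hT Ψ δ C₀ γ ∂Q < ⊤) :
    LiftsInitialLaws hT (playerCost (indivCost p hT Ψ δ C₀) (pairCost p η lam) Q) := by
  intro ω m hω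
  have hmem : ∀ z : G, z ∈ Ω := fun z => hΩ ▸ mem_univ z
  let F : Ω → Curve T Ω := fun y =>
    ⟨fun t => ⟨(ω t : G) + ((y : G) - evalZero hT ω), hmem _⟩, by fun_prop⟩
  have hF : Continuous F := by
    refine ContinuousMap.continuous_of_continuous_uncurry _ ?_
    change Continuous fun z : Ω × Icc (0 : ℝ) T =>
      (⟨(ω z.2 : G) + ((z.1 : G) - evalZero hT ω), hmem _⟩ : Ω)
    fun_prop
  have hF0 : F (evalZero hT ω) = ω := by
    ext t
    simp [F]
  have hcω : indivCost p hT Ψ δ C₀ ω < ⊤ := lt_of_le_of_lt le_self_add (hω.trans_le le_top)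
  have hu := isVelocity_curveVel (kineticEnergy_lt_top_of_indivCost hcω)
  -- Translation leaves the velocity unchanged, so strong convergence of velocities is trivial here.
  have hFu : ∀ y, IsVelocity p (ambient (F y)) (curveVel p ω) := fun y =>
    ⟨hu.1, fun s t => by
      rw [← hu.2 s t]
      simp [ambient, F]⟩
  have hlim := tendsto_playerCost hA hη lam hC hηC hQ
    (by simpa [hF0] using hF.tendsto (evalZero hT ω)) hFu hu tendsto_const_nhds
  obtain ⟨r, hr, hball⟩ := Metric.eventually_nhds_iff.1 (hlim.eventually_lt_const hω)
  refine ⟨r, hr, fun ν hν hνr => ⟨ν.map F,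
    Measure.isProbabilityMeasure_map hF.measurable.aemeasurable, ?_, ?_⟩⟩
  · rw [Measure.map_map (continuous_evalZero hT).measurable hF.measurable]
    have : evalZero hT ∘ F = id := by
      ext y
      simp [F, evalZero]
    rw [this, Measure.map_id]
  · have hm := (lowerSemicontinuous_playerCost (lowerSemicontinuous_indivCost hA)
      (lowerSemicontinuous_totalPair hA hη lam) hQ).measurable
    rw [ae_map_iff hF.measurable.aemeasurable (measurableSet_le hm measurable_const)]
    filter_upwards [hνr] with y hy using (hball hy).le

end Equilibrium

/-! ### Delayed curves and translations in L². -/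

section Delay

variable {d : ℕ} {T : ℝ}

lemma isProjection_id : IsProjection (id : Vec d → Vec d) :=
  ⟨fun _ _ => rfl, fun _ => le_rfl, 1, one_pos, fun _ h _ => h⟩

/-- Extension of a velocity by zero to the real line. -/
def extendVel (u : Vel d T) : ℝ → Vec d := (Ioc (0 : ℝ) T).indicator u

lemma extendVel_ae (u : Vel d T) : extendVel u =ᵐ[volume.restrict (Icc (0 : ℝ) T)] u := by
  have h : ∀ᵐ t ∂(volume.restrict (Ioc (0 : ℝ) T)), extendVel u t = u t := by
    filter_upwards [ae_restrict_mem measurableSet_Ioc] with t ht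
    exact indicator_of_mem ht _
  exact (congrArg (fun μ : Measure ℝ => ∀ᵐ t ∂μ, extendVel u t = u t)
    (Measure.restrict_congr_set (Ioc_ae_eq_Icc (a := (0 : ℝ)) (b := T)))).mp h

lemma memLp_extendVel (u : Vel d T) : MemLp (extendVel u) 2 volume := by
  rw [extendVel, memLp_indicator_iff_restrict measurableSet_Ioc]
  exact (Lp.memLp u).mono_measure (Measure.restrict_mono Ioc_subset_Icc_self le_rfl)

lemma intervalIntegrable_extendVel (u : Vel d T) (a b : ℝ) :
    IntervalIntegrable (extendVel u) volume a b := by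
  refine Integrable.intervalIntegrable ?_
  rw [extendVel, integrable_indicator_iff measurableSet_Ioc]
  have h : IntegrableOn u (Icc 0 T) := (Lp.memLp u).integrable (by norm_num)
  exact h.mono_set Ioc_subset_Icc_self

/-- Extending the velocity by zero means freezing the curve at its endpoints, that is, clamping time
to [0,T]. -/
lemma integral_extendVel (hT : 0 < T) (u : Vel d T) (b : ℝ) :
    ∫ r in (0 : ℝ)..b, extendVel u r = ∫ r in (0 : ℝ)..(projIcc 0 T hT.le b : ℝ), u r := by
  have hz : ∀ a b : ℝ, Disjoint (uIoc a b) (Ioc 0 T) → ∫ r in a..b, extendVel u r = 0 := by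
    intro a b hab
    rw [intervalIntegral.integral_zero_ae]
    exact Eventually.of_forall fun r hr => indicator_of_notMem (hab.notMem_of_mem_left hr) _
  have hin : ∀ b : Icc (0 : ℝ) T, ∫ r in (0 : ℝ)..b, extendVel u r = ∫ r in (0 : ℝ)..b, u r :=
    fun b => intervalIntegral_congr_restrict (extendVel_ae u) ⟨0, left_mem_Icc.2 hT.le⟩ b
  rcases le_total b 0 with hb | hb
  · rw [projIcc_of_le_left _ hb, intervalIntegral.integral_same, hz]
    rw [uIoc_of_ge hb]
    exact Set.disjoint_left.2 fun r hr hr' => absurd hr.2 (not_le.2 hr'.1)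
  rcases le_total b T with hbT | hbT
  · rw [projIcc_of_mem _ ⟨hb, hbT⟩]
    exact hin ⟨b, hb, hbT⟩
  · rw [projIcc_of_right_le _ hbT, ← intervalIntegral.integral_add_adjacent_intervals
      (intervalIntegrable_extendVel u 0 T) (intervalIntegrable_extendVel u T b), hz T b, add_zero]
    · exact hin ⟨T, right_mem_Icc.2 hT.le⟩
    · rw [uIoc_of_le hbT]
      exact Set.disjoint_left.2 fun r hr hr' => absurd hr'.2 (not_le.2 hr.1)

/-- The velocity delayed by a time `τ`. -/
def delayVel (u : Vel d T) (τ : ℝ) : Vel d T :=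
  LpToLpRestrictCLM ℝ (Vec d) ℝ volume 2 (Icc 0 T)
    (DomAddAct.mk (-τ) +ᵥ (memLp_extendVel u).toLp)

lemma delayVel_ae (u : Vel d T) (τ : ℝ) :
    delayVel u τ =ᵐ[volume.restrict (Icc 0 T)] fun t => extendVel u (t - τ) := by
  have h1 := LpToLpRestrictCLM_coeFn ℝ (Icc 0 T)
    (DomAddAct.mk (-τ) +ᵥ (memLp_extendVel u).toLp : Lp (Vec d) 2 (volume : Measure ℝ))
  have h2 : (DomAddAct.mk (-τ) +ᵥ (memLp_extendVel u).toLp : Lp (Vec d) 2 (volume : Measure ℝ))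
      =ᵐ[volume] _ := Lp.coeFn_compMeasurePreserving _ (measurePreserving_vadd (-τ) volume)
  have h3 := (measurePreserving_vadd (-τ) (volume : Measure ℝ)).quasiMeasurePreserving.ae_eq_comp
    (memLp_extendVel u).coeFn_toLp
  filter_upwards [h1, ae_restrict_of_ae h2, ae_restrict_of_ae h3] with t h1 h2 h3
  rw [delayVel, h1, h2]
  refine h3.trans ?_
  simp [sub_eq_add_neg, add_comm]

/-- Translations act continuously on L² of the real line, the exponent being finite. -/
lemma tendsto_delayVel (u : Vel d T) : Tendsto (delayVel u) (𝓝 0) (𝓝 u) := by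
  have : Fact ((2 : ℝ≥0∞) ≠ ⊤) := ⟨by simp⟩
  have h : Continuous (delayVel u) := by
    have h1 : Continuous fun τ : ℝ =>
        (DomAddAct.mk (-τ) +ᵥ (memLp_extendVel u).toLp : Lp (Vec d) 2 (volume : Measure ℝ)) :=
      (DomAddAct.continuous_mk.comp continuous_neg).vadd continuous_const
    exact (LpToLpRestrictCLM ℝ (Vec d) ℝ volume 2 (Icc 0 T)).continuous.comp h1
  have h0 : delayVel u 0 = u := by
    apply Lp.ext
    filter_upwards [delayVel_ae u 0, extendVel_ae u] with t h1 h2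
    rw [h1, sub_zero, h2]
  simpa [h0] using h.tendsto 0

lemma isVelocity_delay (hT : 0 < T) {w : Icc (0 : ℝ) T → Vec d} {u : Vel d T}
    (h : IsVelocity id w u) (τ : ℝ) :
    IsVelocity id (fun t : Icc (0 : ℝ) T => w (projIcc 0 T hT.le (t - τ))) (delayVel u τ) := by
  refine ⟨Lp.memLp _, fun s t => ?_⟩
  have h0 : ∀ b : ℝ, ∫ r in (0 : ℝ)..b, extendVel u r =
      w (projIcc 0 T hT.le b) - w ⟨0, left_mem_Icc.2 hT.le⟩ := fun b => by
    rw [integral_extendVel hT]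
    exact (h.2 ⟨0, left_mem_Icc.2 hT.le⟩ _).symm
  rw [intervalIntegral_congr_restrict (delayVel_ae u τ),
    intervalIntegral.integral_comp_sub_right (fun r => extendVel u r),
    ← intervalIntegral.integral_interval_sub_left
      (intervalIntegrable_extendVel u 0 _) (intervalIntegrable_extendVel u 0 _), h0, h0]
  simp

end Delay

/-! ### Velocities of Lipschitz curves. -/

section Lipschitz

variable {d : ℕ} {T : ℝ}

/-- Lipschitz functions have a bounded velocity. -/
lemma exists_velocity_of_lipschitz (d : ℕ) (T : ℝ) : ∃ c : ℝ, ∀ (L : NNReal) (f : ℝ → Vec d),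
    LipschitzWith L f → ∃ u : Vel d T, ‖u‖ ≤ c * L ∧
      IsVelocity id (fun t : Icc (0 : ℝ) T => f t) u := by
  refine ⟨(measureUnivNNReal (volume.restrict (Icc (0 : ℝ) T)) : ℝ) ^ ((2 : ℝ≥0∞).toReal)⁻¹,
    fun L f hf => ?_⟩
  have hbd : ∀ t, ‖deriv f t‖ ≤ L := fun t => norm_deriv_le_of_lipschitz hf
  have hmem : MemLp (deriv f) 2 (volume.restrict (Icc (0 : ℝ) T)) :=
    MemLp.of_bound (measurable_deriv f).aestronglyMeasurable L (Eventually.of_forall hbd)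
  refine ⟨hmem.toLp, ?_, ?_⟩
  · have h1 := Lp.norm_le_of_ae_bound (f := hmem.toLp) L.2 (by
      filter_upwards [hmem.coeFn_toLp] with t ht
      rw [ht]
      exact hbd t)
    simpa using h1
  · refine IsVelocity.toLp ⟨hmem, fun s t => ?_⟩
    have hint := intervalIntegrable_of_memLp hmem s t
    -- Coordinatewise, this is the fundamental theorem of calculus for scalar absolutely continuous
    -- functions.
    ext k
    have h1 : (∫ r in (s : ℝ)..t, deriv f r) k = ∫ r in (s : ℝ)..t, (deriv f r) k :=
      ((EuclideanSpace.proj (𝕜 := ℝ) k).intervalIntegral_comp_comm hint).symm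
    have hlip : LipschitzWith L (fun r => f r k) := LipschitzWith.of_dist_le_mul fun a b =>
      (PiLp.dist_apply_le (f a) (f b) k).trans (hf.dist_le_mul a b)
    have h2 := ((hlip.lipschitzOnWith (s := uIcc (s : ℝ) t)).absolutelyContinuousOnInterval).integral_deriv_eq_sub
    have h3 : ∫ r in (s : ℝ)..t, (deriv f r) k = ∫ r in (s : ℝ)..t, deriv (fun r => f r k) r := by
      refine intervalIntegral.integral_congr_ae ?_
      filter_upwards [hf.ae_differentiableAt] with r hr _
      exact ((EuclideanSpace.proj (𝕜 := ℝ) k).hasFDerivAt.comp_hasDerivAt r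
        hr.hasDerivAt).deriv.symm
    change f t k - f s k = (∫ r in (s : ℝ)..t, deriv f r) k
    rw [h1, h3, h2]

end Lipschitz

/-! ### Concatenation with short curves in a compact domain. -/

section Concatenation

variable {d : ℕ} {T : ℝ} {Ω : Set (Vec d)}

/-- Follow `σ` backwards during a time `τ`, then `ω`. -/
def catCurve (hT : 0 < T) (ω : Curve T Ω) {τ : ℝ} (hτ : 0 < τ) (σ : Curve 1 Ω)
    (hσ : evalZero one_pos σ = evalZero hT ω) : Curve T Ω where
  -- One formula without cases: before τ the `ω` term, after τ the `σ` term, equals the common base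
  -- point, which the subtraction removes. So the values stay in `Ω`.
  toFun t := ⟨(σ (projIcc 0 1 zero_le_one (1 - t / τ)) : Vec d) +
    ω (projIcc 0 T hT.le (t - τ)) - evalZero hT ω, by
      rcases le_total (t : ℝ) τ with h | h
      · rw [projIcc_of_le_left hT.le (sub_nonpos.2 h)]
        simp [evalZero]
      · rw [projIcc_of_le_left zero_le_one (sub_nonpos.2 ((one_le_div hτ).2 h))]
        have : σ ⟨0, left_mem_Icc.2 zero_le_one⟩ = evalZero hT ω := hσ
        rw [this, add_sub_cancel_left]
        exact Subtype.coe_prop _⟩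
  continuous_toFun := by
    have h1 : Continuous fun t : Icc (0 : ℝ) T => projIcc 0 1 zero_le_one (1 - (t : ℝ) / τ) :=
      continuous_projIcc.comp (by fun_prop)
    have h2 : Continuous fun t : Icc (0 : ℝ) T => projIcc 0 T hT.le ((t : ℝ) - τ) :=
      continuous_projIcc.comp (by fun_prop)
    fun_prop

lemma evalZero_catCurve (hT : 0 < T) (ω : Curve T Ω) {τ : ℝ} (hτ : 0 < τ) (σ : Curve 1 Ω)
    (hσ : evalZero one_pos σ = evalZero hT ω) :
    evalZero hT (catCurve hT ω hτ σ hσ) = σ ⟨1, right_mem_Icc.2 zero_le_one⟩ := by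
  ext1
  change (σ (projIcc 0 1 zero_le_one (1 - 0 / τ)) : Vec d) +
    ω (projIcc 0 T hT.le (0 - τ)) - evalZero hT ω = _
  rw [projIcc_of_le_left hT.le (by linarith), zero_div, sub_zero,
    projIcc_of_right_le zero_le_one le_rfl]
  simp [evalZero]

/-- Running `σ`, of Lipschitz constant Lτ, during a time τ gives speed at most L. The factor `c`
depends only on d and T, so this part of the velocity vanishes in norm as L → 0. -/
lemma exists_velocity_catCurve (d : ℕ) (T : ℝ) (hT : 0 < T) :
    ∃ c : ℝ, ∀ (Ω : Set (Vec d)) (ω : Curve T Ω) (u : Vel d T),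
      IsVelocity id (ambient ω) u → ∀ (τ : ℝ) (hτ : 0 < τ) (L : NNReal) (σ : Curve 1 Ω)
      (hσ : evalZero one_pos σ = evalZero hT ω),
      LipschitzWith (L * Real.toNNReal τ) (fun s => (σ s : Vec d)) →
      ∃ w : Vel d T, ‖w‖ ≤ c * L ∧
        IsVelocity id (ambient (catCurve hT ω hτ σ hσ)) (delayVel u τ - w : Vel d T) := by
  obtain ⟨c, hc⟩ := exists_velocity_of_lipschitz d T
  refine ⟨c, fun Ω ω u hu τ hτ L σ hσ hlip => ?_⟩
  have hf : LipschitzWith L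
      fun t : ℝ => -(σ (projIcc 0 1 zero_le_one (1 - t / τ)) : Vec d) := by
    refine LipschitzWith.of_dist_le_mul fun a b => ?_
    rw [dist_neg_neg]
    refine (hlip.dist_le_mul _ _).trans ?_
    have h1 := (LipschitzWith.projIcc (zero_le_one (α := ℝ))).dist_le_mul (1 - a / τ) (1 - b / τ)
    have h2 : dist (1 - a / τ) (1 - b / τ) = dist a b / τ := by
      rw [dist_sub_left, Real.dist_eq, Real.dist_eq, ← sub_div, abs_div, abs_of_pos hτ]
    rw [h2] at h1
    calc _ ≤ ((L * Real.toNNReal τ : NNReal) : ℝ) * ((1 : NNReal) * (dist a b / τ)) := by gcongr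
      _ = L * dist a b := by
        push_cast
        rw [Real.coe_toNNReal _ hτ.le]
        field_simp
  obtain ⟨w, hw, hwv⟩ := hc L _ hf
  refine ⟨w, hw, ?_⟩
  have h := (isVelocity_delay hT hu τ).sub isProjection_id hwv
  refine ⟨h.1, fun s t => ?_⟩
  rw [← h.2 s t]
  change ((σ (projIcc 0 1 zero_le_one (1 - t / τ)) : Vec d) +
    ω (projIcc 0 T hT.le (t - τ)) - evalZero hT ω) -
    ((σ (projIcc 0 1 zero_le_one (1 - s / τ)) : Vec d) +
    ω (projIcc 0 T hT.le (s - τ)) - evalZero hT ω) =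
    ((ω (projIcc 0 T hT.le (t - τ)) : Vec d) - -(σ (projIcc 0 1 zero_le_one (1 - t / τ)) : Vec d))
    - ((ω (projIcc 0 T hT.le (s - τ)) : Vec d) -
      -(σ (projIcc 0 1 zero_le_one (1 - s / τ)) : Vec d))
  abel

lemma tendsto_catCurve (hT : 0 < T) (ω : Curve T Ω) {τ : ℕ → ℝ} (hτ : ∀ n, 0 < τ n)
    (hτ0 : Tendsto τ atTop (𝓝 0)) {L : ℕ → NNReal} (hL : Tendsto L atTop (𝓝 0))
    (σ : ℕ → Curve 1 Ω) (hσ : ∀ n, evalZero one_pos (σ n) = evalZero hT ω)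
    (hlip : ∀ n, LipschitzWith (L n) (fun s => (σ n s : Vec d))) :
    Tendsto (fun n => catCurve hT ω (hτ n) (σ n) (hσ n)) atTop (𝓝 ω) := by
  rw [ContinuousMap.tendsto_iff_tendstoUniformly, Metric.tendstoUniformly_iff]
  intro ε hε
  have hmod := ω.modulus_pos (h := half_pos hε)
  have hL' : Tendsto (fun n => (L n : ℝ)) atTop (𝓝 0) := by simpa using NNReal.tendsto_coe.2 hL
  filter_upwards [hτ0.eventually_lt_const hmod, hL'.eventually_lt_const (half_pos hε)]
    with n hn hn' t
  have h1 : dist (ω t) (ω (projIcc 0 T hT.le (t - τ n))) < ε / 2 := by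
    refine ω.dist_lt_of_dist_lt_modulus (ε / 2) (half_pos hε) ?_
    have h2 := (LipschitzWith.projIcc hT.le).dist_le_mul (t : ℝ) (t - τ n)
    rw [projIcc_val] at h2
    refine h2.trans_lt ?_
    simpa [abs_of_pos (hτ n)] using hn
  have h2 : dist (σ n (projIcc 0 1 zero_le_one (1 - t / τ n)) : Vec d) (evalZero hT ω) < ε / 2 := by
    rw [← hσ n]
    refine ((hlip n).dist_le_mul _ _).trans_lt (lt_of_le_of_lt ?_ hn')
    have h3 : dist (projIcc 0 1 zero_le_one (1 - (t : ℝ) / τ n))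
        (⟨0, left_mem_Icc.2 zero_le_one⟩ : Icc (0 : ℝ) 1) ≤ 1 := by
      rw [Subtype.dist_eq, Real.dist_eq, sub_zero,
        abs_of_nonneg (projIcc 0 1 zero_le_one _).2.1]
      exact (projIcc 0 1 zero_le_one _).2.2
    exact (mul_le_mul_of_nonneg_left h3 (L n).2).trans_eq (mul_one _)
  rw [Subtype.dist_eq] at h1 ⊢
  change dist (ω t : Vec d) ((σ n (projIcc 0 1 zero_le_one (1 - t / τ n)) : Vec d) +
    ω (projIcc 0 T hT.le (t - τ n)) - evalZero hT ω) < ε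
  rw [dist_eq_norm] at h1 h2 ⊢
  calc _ = ‖((ω t : Vec d) - ω (projIcc 0 T hT.le (t - τ n))) -
        ((σ n (projIcc 0 1 zero_le_one (1 - t / τ n)) : Vec d) - evalZero hT ω)‖ := by
        congr 1; abel
    _ ≤ _ := norm_sub_le _ _
    _ < ε := by linarith

/-- Lipschitz curves from a given point of a compact set form a compact set. -/
lemma isCompact_lipschitzCurves (hΩ : IsCompact Ω) (x : Ω) (L : NNReal) :
    IsCompact {σ : Curve 1 Ω | evalZero one_pos σ = x ∧
      LipschitzWith L (fun s => (σ s : Vec d))} := by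
  set A := {σ : Curve 1 Ω | evalZero one_pos σ = x ∧ LipschitzWith L (fun s => (σ s : Vec d))}
  have : CompactSpace Ω := isCompact_iff_compactSpace.1 hΩ
  have hcl : IsClosed A := by
    have h1 : A = {σ | evalZero one_pos σ = x} ∩
        ⋂ s, ⋂ t, {σ : Curve 1 Ω | dist (σ s) (σ t) ≤ L * dist s t} := by
      ext σ
      simp only [A, mem_ofPred_eq, mem_inter_iff, mem_iInter, lipschitzWith_iff_dist_le_mul]
      rfl
    rw [h1]
    refine (isClosed_eq (continuous_evalZero one_pos) continuous_const).inter
      (isClosed_iInter fun s => isClosed_iInter fun t => isClosed_le ?_ continuous_const)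
    exact (continuous_eval_const s).dist (continuous_eval_const t)
  rw [← hcl.closure_eq]
  refine isCompact_closure_of_equicontinuous isCompact_univ A (fun _ _ _ => mem_univ _) ?_
  refine Metric.equicontinuous_of_continuity_modulus (fun r => L * r) ?_ _ ?_
  · have : Continuous fun r : ℝ => (L : ℝ) * r := by fun_prop
    simpa using this.tendsto 0
  · rintro s t ⟨σ, hσ⟩
    exact hσ.2.dist_le_mul s t

/-- On a compact domain whose geodesic distance is continuous, laws are lifted by concatenation
with short curves. -/
lemma liftsInitialLaws_of_isCompact {hT : 0 < T} {Ψ : Ω → ℝ} {δ C₀ : ℝ}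
    (hA : Admissible id hT Ψ δ C₀) (hΩ : IsCompact Ω) (hgeo : GeodesicTopologyAgrees Ω)
    {η : C(Vec d, ℝ)} (hη : ∀ z, 0 ≤ η z) {C : ℝ} (hC : 0 < C)
    (hηC : ∀ z, η z ≤ C) (lam : ℝ) (Q : Measure (Curve T Ω)) [IsProbabilityMeasure Q]
    (hQ : ∫⁻ γ, indivCost id hT Ψ δ C₀ γ ∂Q < ⊤) :
    LiftsInitialLaws hT (playerCost (indivCost id hT Ψ δ C₀) (pairCost id η lam) Q) := by
  intro ω m hω
  have hcω : indivCost id hT Ψ δ C₀ ω < ⊤ := lt_of_le_of_lt le_self_add (hω.trans_le le_top)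
  have hu := isVelocity_curveVel (kineticEnergy_lt_top_of_indivCost hcω)
  obtain ⟨c, hc⟩ := exists_velocity_catCurve d T hT
  -- A connecting curve of Lipschitz constant τ² traversed in time τ has speed τ → 0. Arguing by
  -- contradiction along τ = 1/(n+1) yields one τ valid for all connecting curves.
  obtain ⟨τ, hτ, hcheap⟩ : ∃ (τ : ℝ) (hτ : 0 < τ), ∀ (σ : Curve 1 Ω)
      (hσ : evalZero one_pos σ = evalZero hT ω),
      LipschitzWith (Real.toNNReal τ * Real.toNNReal τ) (fun s => (σ s : Vec d)) →
      playerCost (indivCost id hT Ψ δ C₀) (pairCost id η lam) Q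
        (catCurve hT ω hτ σ hσ) ≤ m := by
    by_contra hcon
    push Not at hcon
    have hτ : ∀ n : ℕ, 0 < 1 / ((n : ℝ) + 1) := fun n => Nat.one_div_pos_of_nat
    choose σ hσ hlip hbig using fun n : ℕ => hcon _ (hτ n)
    have hτ0 : Tendsto (fun n : ℕ => 1 / ((n : ℝ) + 1)) atTop (𝓝 0) :=
      tendsto_one_div_add_atTop_nhds_zero_nat
    have hL0 : Tendsto (fun n : ℕ => Real.toNNReal (1 / ((n : ℝ) + 1))) atTop (𝓝 0) := by
      simpa using tendsto_real_toNNReal hτ0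
    have hlimγ := tendsto_catCurve hT ω hτ hτ0 (by simpa using hL0.mul hL0) σ hσ hlip
    choose w hw hwv using fun n : ℕ => hc Ω ω _ hu _ (hτ n) _ (σ n) (hσ n) (hlip n)
    have hw0 : Tendsto w atTop (𝓝 0) := by
      refine squeeze_zero_norm hw ?_
      have : Tendsto (fun n : ℕ => ((Real.toNNReal (1 / ((n : ℝ) + 1)) : NNReal) : ℝ)) atTop
          (𝓝 0) := by simpa using NNReal.tendsto_coe.2 hL0
      simpa using this.const_mul c
    have hlimu : Tendsto (fun n : ℕ => delayVel (curveVel id ω) (1 / ((n : ℝ) + 1)) - w n) atTop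
        (𝓝 (curveVel id ω)) := by
      simpa using ((tendsto_delayVel (curveVel id ω)).comp hτ0).sub hw0
    have hlim := tendsto_playerCost hA hη lam hC hηC hQ hlimγ hwv hu hlimu
    obtain ⟨n, hn⟩ := (hlim.eventually_lt_const hω).exists
    exact absurd hn (not_lt.2 (hbig n).le)
  set L : NNReal := Real.toNNReal τ * Real.toNNReal τ with hLdef
  have hL : 0 < L := by
    have : 0 < Real.toNNReal τ := Real.toNNReal_pos.2 hτ
    positivity
  obtain ⟨r, hr, hgeo⟩ := hgeo _ (evalZero hT ω).2 L hL
  let A := {σ : Curve 1 Ω | evalZero one_pos σ = evalZero hT ω ∧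
    LipschitzWith L (fun s => (σ s : Vec d))}
  have : CompactSpace A := isCompact_iff_compactSpace.1 (isCompact_lipschitzCurves hΩ _ L)
  let e : A → Ω := fun σ => σ.1 ⟨1, right_mem_Icc.2 zero_le_one⟩
  have he : Continuous e := (continuous_eval_const _).comp continuous_subtype_val
  let F : A → Curve T Ω := fun σ => catCurve hT ω hτ σ.1 σ.2.1
  have hF : Continuous F := by
    refine ContinuousMap.continuous_of_continuous_uncurry _ ?_
    refine Continuous.subtype_mk ?_ _
    have h1 : Continuous fun z : A × Icc (0 : ℝ) T =>
        projIcc 0 1 zero_le_one (1 - (z.2 : ℝ) / τ) :=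
      continuous_projIcc.comp (by fun_prop)
    have h2 : Continuous fun z : A × Icc (0 : ℝ) T => projIcc 0 T hT.le ((z.2 : ℝ) - τ) :=
      continuous_projIcc.comp (by fun_prop)
    have h3 : Continuous fun z : A × Icc (0 : ℝ) T =>
        z.1.1 (projIcc 0 1 zero_le_one (1 - (z.2 : ℝ) / τ)) :=
      (continuous_subtype_val.comp continuous_fst).eval h1
    have h4 : Continuous fun z : A × Icc (0 : ℝ) T => ω (projIcc 0 T hT.le ((z.2 : ℝ) - τ)) :=
      ω.continuous.comp h2
    exact ((continuous_subtype_val.comp h3).add (continuous_subtype_val.comp h4)).sub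
      continuous_const
  refine ⟨r, hr, fun ν hν hνr => ?_⟩
  -- The geodesic hypothesis says that every nearby point is the end of a curve in the compact set
  -- `A`, so `ν` lifts to a law on `A` without a measurable choice of connecting curves.
  obtain ⟨μ, hμ, hμe⟩ := exists_map_eq_of_compact he ν (by
    filter_upwards [hνr] with y hy
    obtain ⟨ζ, hζL, hζΩ, hζ0, hζ1⟩ := hgeo y y.2 hy
    have hζc : Continuous fun s : Icc (0 : ℝ) 1 => (⟨ζ s, hζΩ s.2⟩ : Ω) :=
      (hζL.continuousOn.domRestrict).subtype_mk _
    refine ⟨⟨⟨_, hζc⟩, Subtype.ext hζ0, ?_⟩, Subtype.ext hζ1⟩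
    exact LipschitzWith.of_dist_le_mul fun s t => hζL.dist_le_mul _ s.2 _ t.2)
  refine ⟨μ.map F, Measure.isProbabilityMeasure_map hF.measurable.aemeasurable, ?_, ?_⟩
  · rw [Measure.map_map (continuous_evalZero hT).measurable hF.measurable, ← hμe]
    congr 1
    ext1 σ
    exact evalZero_catCurve hT ω hτ σ.1 σ.2.1
  · have hm := (lowerSemicontinuous_playerCost (lowerSemicontinuous_indivCost hA)
      (lowerSemicontinuous_totalPair hA hη lam) hQ).measurable
    rw [ae_map_iff hF.measurable.aemeasurable (measurableSet_le hm measurable_const)]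
    exact Eventually.of_forall fun σ => hcheap σ.1 σ.2.1 σ.2.2

end Concatenation

/-! ### Verification of the standing assumptions. -/

section Assembly

variable {d : ℕ} {T : ℝ}

lemma isProjection_torusProj (d : ℕ) : IsProjection (torusProj d) where
  map_add x y := by
    ext i
    simp [torusProj]
  norm_le x := by
    refine (pi_norm_le_iff_of_nonneg (norm_nonneg x)).2 fun i => ?_
    refine le_trans ?_ (PiLp.norm_apply_le x i)
    exact QuotientAddGroup.norm_mk_le_norm
  discrete := by
    -- The kernel is ℤ^d, and each coordinate is an integer of modulus at most ‖x‖ < 1.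
    refine ⟨1, one_pos, fun x hx hx1 => ?_⟩
    ext i
    have h1 : ((x i : ℝ) : UnitAddCircle) = 0 := congrFun hx i
    obtain ⟨n, hn⟩ := (AddCircle.coe_eq_zero_iff (1 : ℝ)).1 h1
    have h2 : |x i| < 1 := by
      rw [← Real.norm_eq_abs]
      exact (PiLp.norm_apply_le x i).trans_lt hx1
    have h3 : (n : ℝ) = x i := by simpa using hn
    have h4 : ((|n| : ℤ) : ℝ) < (1 : ℤ) := by
      rw [Int.cast_abs, h3, Int.cast_one]
      exact h2
    rw [← h3, Int.abs_lt_one_iff.1 (Int.cast_lt.1 h4)]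
    simp

variable {G : Type} [NormedAddCommGroup G] {p : Vec d → G} {Ω : Set G}

lemma admissible_of_bounded (hp : IsProjection p) (hT : 0 < T) {Ψ : Ω → ℝ} (hΨ : Continuous Ψ)
    {δ : ℝ} (hδ : 0 < δ) {C : ℝ} (hC : ∀ x, |Ψ x| ≤ C) :
    Admissible p hT Ψ δ (2 * |C|) where
  proj := hp
  cont := hΨ
  pos := hδ
  nonneg := by positivity
  bound γ _ := by
    have h1 := hC (γ (finalTime hT))
    have h2 := hC (evalZero hT γ)
    have h3 : 0 ≤ δ / 2 * (kineticEnergy p γ).toReal := by positivity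
    calc |terminalGain hT Ψ γ| ≤ |Ψ (γ (finalTime hT))| + |Ψ (evalZero hT γ)| := abs_sub _ _
      _ ≤ _ := by linarith [le_abs_self C]

/-- Young's inequality: the gain is at most L√T ‖u‖ ≤ (δ/4)‖u‖² + L²T/δ, by completing the square.
-/
lemma admissible_of_lipschitz (hp : IsProjection p) (hT : 0 < T) {Ψ : Ω → ℝ}
    {δ : ℝ} (hδ : 0 < δ) {L : NNReal} (hL : LipschitzWith L Ψ) :
    Admissible p hT Ψ δ (L ^ 2 * T / δ) where
  proj := hp
  cont := hL.continuous
  pos := hδ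
  nonneg := by positivity
  bound γ hγ := by
    obtain ⟨u, hu⟩ := exists_vel_of_kineticEnergy_lt_top hγ
    have h1 := norm_sub_le_of_isVelocity hp hu ⟨0, left_mem_Icc.2 hT.le⟩ (finalTime hT)
    rw [kineticEnergy_eq hT hp hu, ENNReal.toReal_ofReal (by positivity)]
    have h2 : |terminalGain hT Ψ γ| ≤ L * (Real.sqrt T * ‖u‖) := by
      refine (hL.dist_le_mul (γ (finalTime hT)) (evalZero hT γ)).trans ?_
      gcongr
      rw [Subtype.dist_eq, dist_eq_norm]
      change ‖((γ (finalTime hT) : G)) - γ ⟨0, left_mem_Icc.2 hT.le⟩‖ ≤ _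
      refine h1.trans_eq ?_
      simp [abs_of_pos hT]
    refine h2.trans ?_
    have h3 : ∀ a s : ℝ, δ / 2 * (a ^ 2 / 2) + L ^ 2 * s ^ 2 / δ - L * (s * a) =
        (δ / 2 * a - L * s) ^ 2 / δ := fun a s => by
      field_simp
      ring
    have h4 := h3 ‖u‖ (Real.sqrt T)
    rw [Real.sq_sqrt hT.le] at h4
    have h5 : 0 ≤ (δ / 2 * ‖u‖ - L * Real.sqrt T) ^ 2 / δ := by positivity
    linarith

end Assembly

end VelocityMFG

end

theorem mainTheorem1 (d : ℕ) (T : ℝ) (hT : 0 < T) (δ lam : ℝ) (hδ : 0 < δ) (hlam : 0 < lam) :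
    -- the domain is the whole space or a compact subset of it
    (∀ (Ω : Set (VelocityMFG.Vec d)),
      (Ω = Set.univ ∨ (IsCompact Ω ∧ VelocityMFG.GeodesicTopologyAgrees Ω)) →
      ∀ (Ψ : Ω → ℝ), Continuous Ψ →
        ((∃ C : ℝ, ∀ x, |Ψ x| ≤ C) ∨ (∃ L : NNReal, LipschitzWith L Ψ)) →
      ∀ (η : VelocityMFG.Vec d → ℝ), Continuous η → (∀ z, 0 ≤ η z) → (∃ C : ℝ, ∀ z, η z ≤ C) →
        (∀ z, η (-z) = η z) →
      ∀ (m₀ : Measure Ω), IsProbabilityMeasure m₀ →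
        ∫⁻ x, ENNReal.ofReal (Ψ x) ∂m₀ < ⊤ →
      ∃ Q ∈ VelocityMFG.initialLaw hT m₀,
        VelocityMFG.IsEquilibrium (id : VelocityMFG.Vec d → VelocityMFG.Vec d)
          hT Ψ δ η lam m₀ Q) ∧
    -- the domain is the torus
    (∀ (Ψ : ↥(Set.univ : Set (VelocityMFG.Torus d)) → ℝ), Continuous Ψ →
      ∀ (η : VelocityMFG.Torus d → ℝ), Continuous η → (∀ z, 0 ≤ η z) → (∀ z, η (-z) = η z) →
      ∀ (m₀ : Measure ↥(Set.univ : Set (VelocityMFG.Torus d))), IsProbabilityMeasure m₀ →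
      ∃ Q ∈ VelocityMFG.initialLaw hT m₀,
        VelocityMFG.IsEquilibrium (VelocityMFG.torusProj d) hT Ψ δ η lam m₀ Q) := by
  constructor
  · intro Ω hΩ Ψ hΨ hΨb η hη hη0 hηC heven m₀ hm₀ hm₀fin
    obtain ⟨C, hC⟩ := hηC
    -- The maximum with 1 provides the strictly positive bound required by `interaction_le`.
    have hC1 : ∀ z, η z ≤ max C 1 := fun z => (hC z).trans (le_max_left _ _)
    have hC0 : 0 < max C 1 := lt_max_of_lt_right one_pos
    have hcl : IsClosed Ω := by
      rcases hΩ with rfl | h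
      · exact isClosed_univ
      · exact h.1.isClosed
    obtain ⟨C₀, hA⟩ : ∃ C₀, VelocityMFG.Admissible
        (id : VelocityMFG.Vec d → VelocityMFG.Vec d) hT Ψ δ C₀ := by
      rcases hΨb with ⟨M, hM⟩ | ⟨L, hL⟩
      · exact ⟨_, VelocityMFG.admissible_of_bounded VelocityMFG.isProjection_id hT hΨ hδ hM⟩
      · exact ⟨_, VelocityMFG.admissible_of_lipschitz VelocityMFG.isProjection_id hT hδ hL⟩
    refine VelocityMFG.exists_equilibrium_of_lifts hA hcl (η := ⟨η, hη⟩) hη0 heven hC0 hC1 lam m₀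
      hm₀fin fun Q hQ hQc => ?_
    rcases hΩ with h | h
    · exact VelocityMFG.liftsInitialLaws_of_eq_univ hA h hη0 hC0 hC1 lam Q hQc
    · exact VelocityMFG.liftsInitialLaws_of_isCompact hA h.1 h.2 hη0 hC0 hC1 lam Q hQc
  · intro Ψ hΨ η hη hη0 heven m₀ hm₀
    -- Compactness of the torus supplies the bounds on η and Ψ, hence also the integrability of Ψ⁺.
    have hbd : ∀ {X : Type} [TopologicalSpace X] [CompactSpace X] (f : X → ℝ), Continuous f →
        ∃ C, ∀ x, |f x| ≤ C := fun f hf => by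
      obtain ⟨C, hC⟩ := isCompact_univ.exists_bound_of_continuousOn hf.continuousOn
      exact ⟨C, fun x => hC x (Set.mem_univ x)⟩
    obtain ⟨C, hC⟩ := hbd η hη
    have hC1 : ∀ z, η z ≤ max C 1 := fun z =>
      (le_abs_self _).trans ((hC z).trans (le_max_left _ _))
    have hC0 : 0 < max C 1 := lt_max_of_lt_right one_pos
    have : CompactSpace ↥(Set.univ : Set (VelocityMFG.Torus d)) :=
      isCompact_iff_compactSpace.1 isCompact_univ
    obtain ⟨M, hM⟩ := hbd Ψ hΨ
    have hA := VelocityMFG.admissible_of_bounded (VelocityMFG.isProjection_torusProj d) hT hΨ hδ hM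
    have hfin : ∫⁻ x, ENNReal.ofReal (Ψ x) ∂m₀ < ⊤ := by
      refine (lintegral_mono fun x =>
        ENNReal.ofReal_le_ofReal ((le_abs_self _).trans (hM x))).trans_lt ?_
      simp
    refine VelocityMFG.exists_equilibrium_of_lifts hA isClosed_univ (η := ⟨η, hη⟩) hη0 heven hC0
      hC1 lam m₀ hfin fun Q hQ hQc => ?_
    exact VelocityMFG.liftsInitialLaws_of_eq_univ hA rfl hη0 hC0 hC1 lam Q hQc
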